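/- Let $\Gamma$ be a $C^\infty$ simple closed convex curve in $\mathbb{R}^2$ with a fixed orientation, parametrized by arc length $s$, with unit tangent $\tau(s)=\Gamma'(s)$, and let $J$ be the rotation of $\mathbb{R}^2$ by $+\pi/2$. Let $\beta>0$ and $r=1/\beta$. Suppose that either $\Gamma$ is oriented clockwise, or $\Gamma$ is oriented counterclockwise and $\beta<\min_\Gamma k$, where $k$ is the curvature of $\Gamma$. The outer magnetic billiard map $T$ of $\Gamma$ is defined as follows. The Larmor circle at $\Gamma(s)$ is the circle of radius $r$ with centre $\Gamma(s)+rJ\tau(s)$, traversed counterclockwise (it is tangent to $\Gamma$ at $\Gamma(s)$ with the orientation of $\Gamma$). If $P$ lies on this circle and the arc from $P$ to $\Gamma(s)$ has angular measure $\varepsilon\in(0,\pi)$, then $T(P)$ is the point of the same circle for which the arc from $\Gamma(s)$ to $T(P)$ has angular measure $\varepsilon$. Let $\Gamma_{+2r}(s)=\Gamma(s)+2rJ\tau(s)$; the map $T$ acts in the open annulus bounded by $\Gamma$ and $\Gamma_{+2r}$. Suppose that there is a non-constant real polynomial $F(x,y)$ with $F\circ T=F$. Then $\Gamma$ and $\Gamma_{+2r}$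 are algebraic: there are real polynomials $f$ and $f_{+2r}$, irreducible over $\mathbb{C}$, that vanish on $\Gamma$ and on $\Gamma_{+2r}$ respectively. For any such $f$ and $f_{+2r}$ the following alternative holds: either $\Gamma$ is a circle, or the affine curves $\{f=0\}$ and $\{f_{+2r}=0\}$ in $\mathbb{C}^2$ are smooth, and, writing $\tilde f,\tilde f_{+2r}$ for the homogenizations in the coordinates $(x:y:z)$ of $\mathbb{C}P^2$, every non-singular point of $\{\tilde f=0\}$ or of $\{\tilde f_{+2r}=0\}$ on the line at infinity $\{z=0\}$, other than the isotropic points $(1:\pm i:0)$, is a point of tangency of that curve with the line $\{z=0\}$. -/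

import Mathlib

/-! The Euclidean plane `ℝ²` is identified with `ℂ`; the standard complex structure `J` (rotation
by a right angle) is multiplication by `Complex.I`, and the rotation by the angle `ε` is
multiplication by `Complex.exp (ε * Complex.I)`. -/

/-- `det (v, w)` for plane vectors `v`, `w`; it is nonnegative iff `w` points to the left of `v`
(or along the line of `v`). -/
noncomputable def planeDet (v w : ℂ) : ℝ := v.re * w.im - v.im * w.re

/-- `γ` is a `C^∞` simple closed plane curve of length `L`, parametrized by arc length. -/
structure IsSmoothSimpleClosedCurve (γ : ℝ → ℂ) (L : ℝ) : Prop where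
  length_pos : 0 < L
  smooth : ContDiff ℝ (⊤ : ℕ∞) γ
  unit_speed : ∀ s, ‖deriv γ s‖ = 1
  periodic : Function.Periodic γ L
  simple : Set.InjOn γ (Set.Ico 0 L)

/-- The closed curve `γ` is convex and oriented counterclockwise: it lies in the closed half-plane
to the left of each of its oriented tangent lines. -/
def IsConvexCounterclockwise (γ : ℝ → ℂ) : Prop :=
  ∀ s t, 0 ≤ planeDet (deriv γ s) (γ t - γ s)

/-- The closed curve `γ` is convex and oriented clockwise: it lies in the closed half-plane
to the right of each of its oriented tangent lines. -/
def IsConvexClockwise (γ : ℝ → ℂ) : Prop :=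
  ∀ s t, planeDet (deriv γ s) (γ t - γ s) ≤ 0

/-- The signed curvature of a curve parametrized by arc length. -/
noncomputable def signedCurvature (γ : ℝ → ℂ) (s : ℝ) : ℝ :=
  planeDet (deriv γ s) (deriv (deriv γ) s)

/-- The parallel curve `γ_{+d}(s) = γ(s) + d J τ(s)`, where `τ = γ'` is the unit tangent vector. -/
noncomputable def parallelCurve (γ : ℝ → ℂ) (d : ℝ) (s : ℝ) : ℂ :=
  γ s + d * (Complex.I * deriv γ s)

/-- The point reached from the tangency point `γ s` by moving through the angle `ε`,
counterclockwise, along the Larmor circle of radius `r` that is tangent to `γ` at `γ s` with the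
agreed orientation. The centre of that circle is `γ s + r J τ(s)`. -/
noncomputable def larmorPoint (γ : ℝ → ℂ) (r s ε : ℝ) : ℂ :=
  parallelCurve γ r s + Complex.exp (ε * Complex.I) * (γ s - parallelCurve γ r s)

/-- The graph of the outer magnetic billiard map `T` of `γ`: `T P = Q` if `P` and `Q` lie on one
Larmor circle of radius `r` tangent to `γ` at some `γ s` with the agreed orientation, and the arc
of that circle from `P` to `γ s` and the arc from `γ s` to `Q` have the same angular measure
`ε ∈ (0, π)`. -/
def OuterBilliardGraph (γ : ℝ → ℂ) (r : ℝ) (P Q : ℂ) : Prop :=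
  ∃ s ε : ℝ, 0 < ε ∧ ε < Real.pi ∧ P = larmorPoint γ r s (-ε) ∧ Q = larmorPoint γ r s ε

/-- The value of a real polynomial in `x, y` at a point of the plane. -/
noncomputable def planeEval (P : ℂ) (F : MvPolynomial (Fin 2) ℝ) : ℝ :=
  MvPolynomial.eval ![P.re, P.im] F

/-- The polynomial `F` is invariant under the outer magnetic billiard map: `F ∘ T = F`. -/
def IsOuterBilliardInvariant (γ : ℝ → ℂ) (r : ℝ) (F : MvPolynomial (Fin 2) ℝ) : Prop :=
  ∀ P Q, OuterBilliardGraph γ r P Q → planeEval Q F = planeEval P F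

/-- The trace of `γ` is a circle. -/
def IsCircleCurve (γ : ℝ → ℂ) : Prop :=
  ∃ (c : ℂ) (R : ℝ), 0 < R ∧ Set.range γ = Metric.sphere c R

/-- A real polynomial in two variables, regarded as a complex polynomial. -/
noncomputable def complexify (f : MvPolynomial (Fin 2) ℝ) : MvPolynomial (Fin 2) ℂ :=
  MvPolynomial.map (algebraMap ℝ ℂ) f

/-- `f` is an irreducible defining polynomial of the curve `γ`: a real polynomial, irreducible
over `ℂ`, whose zero set contains `γ`. -/
def IsDefiningPolynomial (γ : ℝ → ℂ) (f : MvPolynomial (Fin 2) ℝ) : Prop :=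
  Irreducible (complexify f) ∧ ∀ s, planeEval (γ s) f = 0

/-- The affine curve `{f = 0}` in `ℂ²` (for a reduced `f`) is smooth. -/
def IsSmoothAffineCurve (f : MvPolynomial (Fin 2) ℂ) : Prop :=
  ∀ p : Fin 2 → ℂ, MvPolynomial.eval p f = 0 →
    ∃ i, MvPolynomial.eval p (MvPolynomial.pderiv i f) ≠ 0

/-- The homogenization of `f(x, y)`, in the homogeneous coordinates `(x : y : z)`, where
`x, y, z` are the variables with index `0, 1, 2`. -/
noncomputable def homogenization (f : MvPolynomial (Fin 2) ℂ) : MvPolynomial (Fin 3) ℂ :=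
  ∑ d ∈ f.support, MvPolynomial.C (MvPolynomial.coeff d f) *
    (MvPolynomial.X 0 ^ d 0 * MvPolynomial.X 1 ^ d 1 *
      MvPolynomial.X 2 ^ (f.totalDegree - (d 0 + d 1)))

/-- `Z` (homogeneous coordinates of a point of `ℂP²`) is a non-singular point of the projective
curve `{h = 0}`. -/
def IsNonsingularPoint (h : MvPolynomial (Fin 3) ℂ) (Z : Fin 3 → ℂ) : Prop :=
  MvPolynomial.eval Z h = 0 ∧ ∃ i, MvPolynomial.eval Z (MvPolynomial.pderiv i h) ≠ 0

/-- The isotropic points `(1 : ± i : 0)`. -/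
def IsIsotropicPoint (Z : Fin 3 → ℂ) : Prop :=
  ∃ c : ℂ, c ≠ 0 ∧ (Z = c • ![1, Complex.I, 0] ∨ Z = c • ![1, -Complex.I, 0])

/-- The tangent line of the projective curve `{h = 0}` at its non-singular point `Z`. -/
def projTangentLine (h : MvPolynomial (Fin 3) ℂ) (Z : Fin 3 → ℂ) : Set (Fin 3 → ℂ) :=
  {W | ∑ i, MvPolynomial.eval Z (MvPolynomial.pderiv i h) * W i = 0}

/-- Every non-singular intersection point of the projective closure of `{f = 0}` with the line at
infinity `{z = 0}`, other than the isotropic points, is a point of tangency with that line. -/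
def IsTangentAtInfinity (f : MvPolynomial (Fin 2) ℂ) : Prop :=
  ∀ Z : Fin 3 → ℂ, Z ≠ 0 → Z 2 = 0 → IsNonsingularPoint (homogenization f) Z →
    ¬ IsIsotropicPoint Z → projTangentLine (homogenization f) Z = {W | W 2 = 0}

/-! Each Larmor circle touches Γ at Γ(s) and Γ_{+2r} at the antipodal point, and on it `T` exchanges
points that are mirror images in the common normal. Both curves are therefore instances of one
structure, `IsTangentCircleFrame`: a closed curve δ with a field of tangent circles of radius r,
nowhere osculating, on each of which F is even in the angle ε measured from the point of tangency.

Evenness kills the first derivative of F along δ, so F is a constant c on δ. This makes δ algebraic,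
and F = c + f^m g with f irreducible, f ∤ g. Along a tangent circle f vanishes to second order, and
the next coefficient in the expansion of the even function F - c gives a relation between third
derivatives of f and first derivatives of g (`third_order`). It integrates: with ρ the derivative of
f along Jv, the quantity g^3 (ρ^2 (r f_vv + ρ))^m is a constant K along δ
(`exists_curvature_integral`). Non-osculation gives K ≠ 0. Since ρ^2 = |∇f|^2, rationalising the
square root turns this into a polynomial identity modulo f, valid on the whole complex curve. At a
singular point it reads K^2 = 0, so there are none (`isSmoothAffineCurve`).

At infinity the full reflection law is extended to the complex curve, up to the sign of the square
root |∇f| (`eval_reflection`). Along a branch crossing the line at infinity transversally in a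
non-isotropic direction, the two mirror points differ by a fixed nonzero shift along the asymptote
and by o(t) across it, where 1/t is the distance scale. The leading term of F in the asymptotic
direction separates them, a contradiction (`not_transversal_at_infinity`). -/

namespace OuterMagneticBilliard

/-! ### Elimination for plane curves without a common component -/

open Polynomial in
-- In positive degree r is the resultant of f and P. By Gauss's lemma f stays irreducible over the
-- fraction field and still does not divide P there, so the two are coprime and the resultant is
-- nonzero. In degree 0 f is itself the constant.
theorem exists_mul_add_mul_eq_C_of_irreducible {R : Type*} [CommRing R] [IsDomain R]
    [IsGCDMonoid R] {f P : R[X]} (hf : Irreducible f) (h : ¬ f ∣ P) :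
    ∃ a b : R[X], ∃ r : R, r ≠ 0 ∧ a * f + b * P = C r := by
  by_cases hd : f.natDegree = 0
  · obtain ⟨c, hc⟩ := natDegree_eq_zero.1 hd
    refine ⟨1, 0, c, ?_, by simp [hc]⟩
    rintro rfl
    exact hf.ne_zero (by simp [← hc])
  · have hp : f.IsPrimitive := hf.isPrimitive hd
    have hfK := (hp.irreducible_iff_irreducible_map_fraction_map (K := FractionRing R)).1 hf
    have hnd : ¬ f.map (algebraMap R (FractionRing R)) ∣ P.map (algebraMap R (FractionRing R)) :=
      fun hh => h (hp.dvd_of_fraction_map_dvd_fraction_map hh)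
    have hinj := IsFractionRing.injective R (FractionRing R)
    have hco : IsCoprime (f.map (algebraMap R (FractionRing R)))
        (P.map (algebraMap R (FractionRing R))) :=
      (hfK.coprime_iff_not_dvd).2 hnd
    have hres : resultant f P ≠ 0 := by
      intro h0
      have h1 : resultant (f.map (algebraMap R (FractionRing R)))
          (P.map (algebraMap R (FractionRing R))) = 0 := by
        rw [natDegree_map_eq_of_injective hinj, natDegree_map_eq_of_injective hinj,
          resultant_map_map, h0, map_zero]
      exact (resultant_eq_zero_iff.1 h1).2 hco
    obtain ⟨p, q, -, -, e⟩ := exists_mul_add_mul_eq_C_resultant f P le_rfl le_rfl (Or.inl hd)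
    exact ⟨p, q, _, hres, by rw [← e]; ring⟩

theorem exists_elimination_one {f P : MvPolynomial (Fin 2) ℂ} (hf : Irreducible f)
    (h : ¬ f ∣ P) :
    ∃ A B : MvPolynomial (Fin 2) ℂ, ∃ R : Polynomial ℂ, R ≠ 0 ∧
      A * f + B * P = Polynomial.aeval (MvPolynomial.X 1) R := by
  let e := MvPolynomial.finSuccEquiv ℂ 1
  obtain ⟨a, b, r, hr, hab⟩ := exists_mul_add_mul_eq_C_of_irreducible
    (f := e f) (P := e P) ((MulEquiv.irreducible_iff e).2 hf) (by rwa [map_dvd_iff])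
  let u := MvPolynomial.uniqueAlgEquiv ℂ (Fin 1)
  refine ⟨e.symm a, e.symm b, u r, by simpa using hr, ?_⟩
  apply e.injective
  rw [map_add, map_mul, map_mul, e.apply_symm_apply, e.apply_symm_apply, hab,
    ← Polynomial.aeval_algHom_apply]
  have h1 : e (MvPolynomial.X 1) = Polynomial.C (MvPolynomial.X 0) :=
    MvPolynomial.finSuccEquiv_X_succ (j := 0)
  rw [h1]
  have h2 : ∀ q : MvPolynomial (Fin 1) ℂ, Polynomial.C q =
      Polynomial.aeval (Polynomial.C (MvPolynomial.X 0 : MvPolynomial (Fin 1) ℂ)) (u q) := by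
    intro q
    have : (Polynomial.CAlgHom : MvPolynomial (Fin 1) ℂ →ₐ[ℂ] _) =
        (Polynomial.aeval (Polynomial.C (MvPolynomial.X 0 : MvPolynomial (Fin 1) ℂ))).comp
          u.toAlgHom := by
      refine MvPolynomial.algHom_ext fun i => ?_
      obtain rfl := Subsingleton.elim i 0
      simp [u]
    exact DFunLike.congr_fun this q
  exact h2 r

/-- Two plane curves without a common component meet in points whose `i`-th coordinates are roots
of a nonzero polynomial. -/
theorem exists_elimination {f P : MvPolynomial (Fin 2) ℂ} (hf : Irreducible f)
    (h : ¬ f ∣ P) (i : Fin 2) :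
    ∃ A B : MvPolynomial (Fin 2) ℂ, ∃ R : Polynomial ℂ, R ≠ 0 ∧
      A * f + B * P = Polynomial.aeval (MvPolynomial.X i) R := by
  fin_cases i
  · let e := MvPolynomial.renameEquiv ℂ (Equiv.swap (0 : Fin 2) 1)
    obtain ⟨A, B, R, hR, hAB⟩ := exists_elimination_one (f := e f) (P := e P)
      ((MulEquiv.irreducible_iff e).2 hf) (by rwa [map_dvd_iff])
    refine ⟨e.symm A, e.symm B, R, hR, ?_⟩
    apply e.injective
    rw [map_add, map_mul, map_mul, e.apply_symm_apply, e.apply_symm_apply, hAB,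
      ← Polynomial.aeval_algHom_apply]
    simp [e]
  · exact exists_elimination_one hf h

/-! ### Polynomials along plane curves -/

theorem contDiff_eval_mvPolynomial {σ E : Type*} [NormedAddCommGroup E] [NormedSpace ℝ E]
    {n : WithTop ℕ∞} {x : E → σ → ℂ} (hx : ∀ i, ContDiff ℝ n fun t => x t i)
    (P : MvPolynomial σ ℂ) : ContDiff ℝ n fun t => MvPolynomial.eval (x t) P := by
  induction P using MvPolynomial.induction_on with
  | C a => simpa using contDiff_const
  | add p q hp hq => simpa using hp.add hq
  | mul_X p i hp => simpa using hp.mul (hx i)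

theorem hasDerivAt_eval_mvPolynomial {σ 𝕜 : Type*} [Fintype σ] [NontriviallyNormedField 𝕜]
    [NormedAlgebra 𝕜 ℂ] {x : 𝕜 → σ → ℂ} {x' : σ → ℂ} {t : 𝕜}
    (hx : ∀ i, HasDerivAt (fun t => x t i) (x' i) t) (P : MvPolynomial σ ℂ) :
    HasDerivAt (fun t => MvPolynomial.eval (x t) P)
      (∑ i, MvPolynomial.eval (x t) (MvPolynomial.pderiv i P) * x' i) t := by
  classical
  induction P using MvPolynomial.induction_on with
  | C a => simpa using hasDerivAt_const t a
  | add p q hp hq =>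
    convert! hp.add hq using 1
    · simp [funext_iff]
    · simp [add_mul, Finset.sum_add_distrib]
  | mul_X p i hp =>
    have h := hp.mul (hx i)
    simp only [map_mul, MvPolynomial.eval_X]
    convert! h using 1
    simp only [Derivation.leibniz, MvPolynomial.pderiv_X, smul_eq_mul, map_add, map_mul,
      MvPolynomial.eval_X, add_mul, Finset.sum_add_distrib]
    rw [Finset.sum_eq_single i (fun j _ hj => by simp [hj.symm])
      (by simp), Finset.sum_mul]
    simp only [Pi.single_eq_same, map_one, mul_one]
    rw [add_comm]
    congr 1
    exact Finset.sum_congr rfl fun j _ => by ring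

/-- The value of a complex polynomial at a real point of the plane. -/
noncomputable def realPointEval (P : MvPolynomial (Fin 2) ℂ) (z : ℂ) : ℂ :=
  MvPolynomial.eval ![(z.re : ℂ), (z.im : ℂ)] P

theorem realPointEval_complexify (F : MvPolynomial (Fin 2) ℝ) (z : ℂ) :
    realPointEval (complexify F) z = (planeEval z F : ℂ) := by
  have h : ![(z.re : ℂ), (z.im : ℂ)] = fun i => algebraMap ℝ ℂ (![z.re, z.im] i) := by
    funext i; fin_cases i <;> rfl
  rw [realPointEval, complexify, planeEval, MvPolynomial.eval_map, h]
  exact (MvPolynomial.eval₂_comp_left (algebraMap ℝ ℂ) (RingHom.id ℝ) ![z.re, z.im] F).symm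

/-- The derivative of the polynomial `P` at a real point in the direction of the plane vector
`w`. -/
noncomputable def dirDeriv (P : MvPolynomial (Fin 2) ℂ) (z w : ℂ) : ℂ :=
  realPointEval (MvPolynomial.pderiv 0 P) z * w.re +
    realPointEval (MvPolynomial.pderiv 1 P) z * w.im

theorem hasDerivAt_realPointEval {p : ℝ → ℂ} {p' : ℂ} {t : ℝ} (hp : HasDerivAt p p' t)
    (P : MvPolynomial (Fin 2) ℂ) :
    HasDerivAt (fun t => realPointEval P (p t)) (dirDeriv P (p t) p') t := by
  have hre : HasDerivAt (fun t => ((p t).re : ℂ)) (p'.re : ℂ) t :=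
    ((Complex.ofRealCLM.comp Complex.reCLM).hasFDerivAt.comp_hasDerivAt t hp)
  have him : HasDerivAt (fun t => ((p t).im : ℂ)) (p'.im : ℂ) t :=
    ((Complex.ofRealCLM.comp Complex.imCLM).hasFDerivAt.comp_hasDerivAt t hp)
  have h := hasDerivAt_eval_mvPolynomial (x := fun t => ![((p t).re : ℂ), ((p t).im : ℂ)])
    (x' := ![(p'.re : ℂ), (p'.im : ℂ)]) (t := t)
    (by intro i; fin_cases i; exacts [hre, him]) P
  rw [Fin.sum_univ_two] at h
  exact h

theorem contDiff_realPointEval {p : ℝ → ℂ} {n : WithTop ℕ∞} (hp : ContDiff ℝ n p)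
    (P : MvPolynomial (Fin 2) ℂ) : ContDiff ℝ n fun t => realPointEval P (p t) := by
  refine contDiff_eval_mvPolynomial (x := fun t => ![((p t).re : ℂ), ((p t).im : ℂ)]) ?_ P
  intro i
  fin_cases i
  · exact (Complex.ofRealCLM.comp Complex.reCLM).contDiff.comp hp
  · exact (Complex.ofRealCLM.comp Complex.imCLM).contDiff.comp hp

/-! ### Polynomials vanishing on a closed regular curve -/

/-- A closed regular smooth plane curve. -/
structure IsRegularClosedCurve (δ : ℝ → ℂ) (L : ℝ) : Prop where
  length_pos : 0 < L
  smooth : ContDiff ℝ (⊤ : ℕ∞) δ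
  deriv_ne : ∀ s, deriv δ s ≠ 0
  periodic : Function.Periodic δ L

namespace IsRegularClosedCurve

variable {δ : ℝ → ℂ} {L : ℝ}

theorem hasDerivAt (h : IsRegularClosedCurve δ L) (s : ℝ) : HasDerivAt δ (deriv δ s) s :=
  ((h.smooth.differentiable (by simp)) s).hasDerivAt

/-- The curve is contained in no line, real or complex. -/
theorem not_const_linear (h : IsRegularClosedCurve δ L) {a b c : ℂ} (hab : a ≠ 0 ∨ b ≠ 0) :
    ∃ s, a * (δ s).re + b * (δ s).im ≠ c := by
  by_contra! hc
  have hre : ∀ s, HasDerivAt (fun t => (δ t).re) (deriv δ s).re s := fun s =>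
    Complex.reCLM.hasFDerivAt.comp_hasDerivAt s (h.hasDerivAt s)
  have him : ∀ s, HasDerivAt (fun t => (δ t).im) (deriv δ s).im s := fun s =>
    Complex.imCLM.hasFDerivAt.comp_hasDerivAt s (h.hasDerivAt s)
  have real : ∀ a b c : ℝ, (a ≠ 0 ∨ b ≠ 0) → ¬ ∀ s, a * (δ s).re + b * (δ s).im = c := by
    intro a b c hab hc
    have h1 : ∀ s, a * (deriv δ s).re + b * (deriv δ s).im = 0 := by
      intro s
      have h2 := ((hre s).const_mul a).add ((him s).const_mul b)
      have h3 : HasDerivAt (fun _ : ℝ => c) 0 s := hasDerivAt_const s c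
      have h4 : ((fun t => a * (δ t).re) + fun t => b * (δ t).im) = fun _ => c := by
        funext t; exact hc t
      rw [h4] at h2
      exact h2.unique h3
    have hk : ∀ s, HasDerivAt (fun t => a * (δ t).im - b * (δ t).re)
        (a * (deriv δ s).im - b * (deriv δ s).re) s := fun s =>
      ((him s).const_mul a).sub ((hre s).const_mul b)
    -- Rolle on one period for the coordinate along the supposed line: at its critical point both
    -- components of the velocity vanish.
    obtain ⟨s, -, hs⟩ := exists_hasDerivAt_eq_zero h.length_pos
      (f := fun t => a * (δ t).im - b * (δ t).re)
      (f' := fun s => a * (deriv δ s).im - b * (deriv δ s).re)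
      (fun s _ => (hk s).continuousAt.continuousWithinAt)
      (by have := h.periodic 0; simp only [zero_add] at this; simp [this]) (fun s _ => hk s)
    apply h.deriv_ne s
    have h5 := h1 s
    have hpos : 0 < a ^ 2 + b ^ 2 := by
      rcases hab with h | h <;> positivity
    have e1 : (a ^ 2 + b ^ 2) * (deriv δ s).re = 0 := by linear_combination a * h5 - b * hs
    have e2 : (a ^ 2 + b ^ 2) * (deriv δ s).im = 0 := by linear_combination b * h5 + a * hs
    apply Complex.ext
    · simpa [hpos.ne'] using e1
    · simpa [hpos.ne'] using e2
  have h1 : ∀ s, a.re * (δ s).re + b.re * (δ s).im = c.re := fun s => by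
    simpa using congrArg Complex.re (hc s)
  have h2 : ∀ s, a.im * (δ s).re + b.im * (δ s).im = c.im := fun s => by
    simpa using congrArg Complex.im (hc s)
  have h3 := fun hh => real _ _ _ hh h1
  have h4 := fun hh => real _ _ _ hh h2
  simp only [imp_false, not_or, not_not] at h3 h4
  rcases hab with hab | hab
  · exact hab (Complex.ext h3.1 h4.1)
  · exact hab (Complex.ext h3.2 h4.2)

/-- A nonzero polynomial does not vanish along a nonconstant linear coordinate. -/
theorem exists_eval_ne_zero (h : IsRegularClosedCurve δ L) {a b : ℂ} (hab : a ≠ 0 ∨ b ≠ 0)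
    {R : Polynomial ℂ} (hR : R ≠ 0) : ∃ s, R.eval (a * (δ s).re + b * (δ s).im) ≠ 0 := by
  by_contra! hc
  have hcont : Continuous fun s => a * ((δ s).re : ℂ) + b * ((δ s).im : ℂ) := by
    have := h.smooth.continuous
    fun_prop
  -- The coordinate would map the connected line into the finite root set of R, hence be constant.
  have hfin : (Set.range fun s => a * ((δ s).re : ℂ) + b * ((δ s).im : ℂ)).Finite :=
    (R.roots.toFinset.finite_toSet).subset (by
      rintro _ ⟨s, rfl⟩
      simpa [hR] using hc s)
  have hsub := hfin.countable.isTotallyDisconnected _ subset_rfl (isPreconnected_range hcont)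
  obtain ⟨s, hs⟩ := h.not_const_linear (c := a * ((δ 0).re : ℂ) + b * ((δ 0).im : ℂ)) hab
  exact hs (hsub ⟨s, rfl⟩ ⟨0, rfl⟩)

/-- An irreducible polynomial vanishing on the curve divides every polynomial that does. -/
theorem dvd_of_vanish (h : IsRegularClosedCurve δ L) {f P : MvPolynomial (Fin 2) ℂ}
    (hf : Irreducible f) (hfδ : ∀ s, realPointEval f (δ s) = 0)
    (hP : ∀ s, realPointEval P (δ s) = 0) : f ∣ P := by
  by_contra hnd
  obtain ⟨A, B, R, hR, e⟩ := exists_elimination hf hnd 0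
  obtain ⟨s, hs⟩ := h.exists_eval_ne_zero (a := 1) (b := 0) (by simp) hR
  apply hs
  have := congrArg (MvPolynomial.eval ![((δ s).re : ℂ), ((δ s).im : ℂ)]) e
  rw [map_add, map_mul, map_mul] at this
  have h1 := hfδ s
  have h2 := hP s
  rw [realPointEval] at h1 h2
  rw [h1, h2, mul_zero, mul_zero, add_zero] at this
  have h3 := Polynomial.aeval_algHom_apply
    (MvPolynomial.aeval (R := ℂ) ![((δ s).re : ℂ), ((δ s).im : ℂ)]) (MvPolynomial.X 0) R
  rw [MvPolynomial.aeval_eq_eval, ← this] at h3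
  simpa using h3

end IsRegularClosedCurve

end OuterMagneticBilliard

/-! ### Flat functions and the real irreducible equation of a smooth curve -/

namespace OuterMagneticBilliard

open Filter Topology Asymptotics

/-- A function is flat at `s₀` if it vanishes there to infinite order. -/
def IsFlatAt (φ : ℝ → ℂ) (s₀ : ℝ) : Prop :=
  ∀ n : ℕ, φ =o[𝓝 s₀] fun s => (s - s₀) ^ n

/-- All derivatives vanish on the open set U, hence by continuity on its closure, and Taylor's
formula applies there. -/
theorem isFlatAt_of_mem_closure {φ : ℝ → ℂ} (hφ : ContDiff ℝ (⊤ : ℕ∞) φ) {U : Set ℝ}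
    (hU : IsOpen U) (h0 : ∀ s ∈ U, φ s = 0) {s₀ : ℝ} (hs : s₀ ∈ closure U) : IsFlatAt φ s₀ := by
  have hd : ∀ n : ℕ, iteratedDeriv n φ s₀ = 0 := by
    intro n
    have hclosed : IsClosed {s | iteratedDeriv n φ s = 0} :=
      isClosed_eq (hφ.continuous_iteratedDeriv n (by exact_mod_cast le_top)) continuous_const
    refine closure_minimal (fun s hs => ?_) hclosed hs
    have he : φ =ᶠ[𝓝 s] fun _ => (0 : ℂ) := by
      filter_upwards [hU.mem_nhds hs] with t ht using h0 t ht
    have := (he.iteratedDeriv_eq n)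
    simp [this]
  intro n
  have h := taylor_isLittleO_univ (x₀ := s₀) (n := n) (hφ.of_le (by exact_mod_cast le_top))
  have hz : ∀ x, taylorWithinEval φ n Set.univ s₀ x = 0 := by
    intro x
    rw [taylor_within_apply]
    refine Finset.sum_eq_zero fun k _ => ?_
    rw [iteratedDerivWithin_univ, hd k, smul_zero]
  simpa only [hz, sub_zero] using h

/-- If x(s₀) is a root of R of multiplicity m, then R(x(s)) / (s - s₀)^m has the nonzero limit x'^m
q(x(s₀)), where q is the cofactor of the root. -/
theorem not_isFlatAt_eval_comp {R : Polynomial ℂ} (hR : R ≠ 0) {x : ℝ → ℂ} {x' : ℂ} {s₀ : ℝ}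
    (hx : HasDerivAt x x' s₀) (hx' : x' ≠ 0) : ¬ IsFlatAt (fun s => R.eval (x s)) s₀ := by
  intro h
  obtain ⟨q, hq, hnd⟩ :=
    Polynomial.exists_eq_pow_rootMultiplicity_mul_and_not_dvd R hR (x s₀)
  set m := R.rootMultiplicity (x s₀)
  have h1 : Tendsto (fun s => slope x s₀ s ^ m * q.eval (x s)) (𝓝[≠] s₀)
      (𝓝 (x' ^ m * q.eval (x s₀))) := by
    refine (hx.tendsto_slope.pow m).mul ?_
    exact (q.continuous.tendsto _).comp (hx.continuousAt.tendsto.mono_left nhdsWithin_le_nhds)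
  have h2 := ((h m).mono nhdsWithin_le_nhds : _ =o[𝓝[≠] s₀] _)
  have h3 : (fun s => R.eval (x s)) =ᶠ[𝓝[≠] s₀]
      fun s => ((s - s₀) ^ m) • (slope x s₀ s ^ m * q.eval (x s)) := by
    filter_upwards [self_mem_nhdsWithin] with s hs
    have hs' : (s : ℂ) - s₀ ≠ 0 := by
      rw [← Complex.ofReal_sub]; exact_mod_cast sub_ne_zero.2 hs
    conv_lhs => rw [hq]
    simp only [Polynomial.eval_mul, Polynomial.eval_pow, Polynomial.eval_sub, Polynomial.eval_X,
      Polynomial.eval_C, slope_def_module, Complex.real_smul]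
    push_cast
    rw [mul_pow, inv_pow]
    field_simp
  have h4 : Tendsto (fun s => slope x s₀ s ^ m * q.eval (x s)) (𝓝[≠] s₀) (𝓝 0) := by
    rw [tendsto_zero_iff_norm_tendsto_zero]
    have h5 := h2.norm_norm.tendsto_div_nhds_zero
    refine h5.congr' ?_
    filter_upwards [h3, self_mem_nhdsWithin] with s hs hne
    rw [hs, norm_smul]
    have : ‖(s - s₀) ^ m‖ ≠ 0 := by
      rw [norm_ne_zero_iff]; exact pow_ne_zero _ (sub_ne_zero.2 hne)
    field_simp
  have h6 := tendsto_nhds_unique h1 h4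
  rw [mul_eq_zero] at h6
  rcases h6 with h6 | h6
  · exact pow_ne_zero m hx' h6
  · exact hnd (Polynomial.dvd_iff_isRoot.2 h6)

namespace IsRegularClosedCurve

variable {δ : ℝ → ℂ} {L : ℝ}

/-- Elimination makes a nonzero polynomial of either coordinate flat at s₀. Such a composite is not
flat where the coordinate has nonzero derivative, and regularity provides such a coordinate. -/
theorem not_isFlatAt_of_not_dvd (h : IsRegularClosedCurve δ L) {q Q : MvPolynomial (Fin 2) ℂ}
    (hq : Irreducible q) (hnd : ¬ q ∣ Q) (s₀ : ℝ)
    (h1 : IsFlatAt (fun s => realPointEval q (δ s)) s₀)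
    (h2 : IsFlatAt (fun s => realPointEval Q (δ s)) s₀) : False := by
  have hδ := h.hasDerivAt s₀
  have key : ∀ i : Fin 2, ∀ x' : ℂ,
      HasDerivAt (fun s => ![((δ s).re : ℂ), ((δ s).im : ℂ)] i) x' s₀ → x' = 0 := by
    intro i x' hx
    by_contra hx'
    obtain ⟨A, B, R, hR, e⟩ := exists_elimination hq hnd i
    refine not_isFlatAt_eval_comp hR hx hx' fun n => ?_
    have hA := ((contDiff_realPointEval h.smooth A).continuous.tendsto s₀).isBigO_one ℝ
    have hB := ((contDiff_realPointEval h.smooth B).continuous.tendsto s₀).isBigO_one ℝ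
    have h3 := (hA.mul_isLittleO (h1 n)).add (hB.mul_isLittleO (h2 n))
    simp only [one_mul] at h3
    refine h3.congr_left fun s => ?_
    have h4 := congrArg (MvPolynomial.eval ![((δ s).re : ℂ), ((δ s).im : ℂ)]) e
    have h5 := Polynomial.aeval_algHom_apply
      (MvPolynomial.aeval (R := ℂ) ![((δ s).re : ℂ), ((δ s).im : ℂ)]) (MvPolynomial.X i) R
    rw [MvPolynomial.aeval_eq_eval, ← h4, MvPolynomial.eval_X] at h5
    rw [map_add, map_mul, map_mul] at h5
    simpa [realPointEval, ← Polynomial.coe_aeval_eq_eval] using h5.symm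
  have hre := key 0 _ ((Complex.ofRealCLM.comp Complex.reCLM).hasFDerivAt.comp_hasDerivAt s₀ hδ)
  have him := key 1 _ ((Complex.ofRealCLM.comp Complex.imCLM).hasFDerivAt.comp_hasDerivAt s₀ hδ)
  apply h.deriv_ne s₀
  apply Complex.ext
  · simpa using hre
  · simpa using him

/-- δ is only smooth, so the identity theorem for analytic functions is not available; flatness
replaces it. Where one factor is nonzero the other vanishes, hence is flat on the closure of that
set. The two closures cover ℝ, so if both are nonempty they meet, and there both factors are flat.
-/
theorem vanish_or_vanish (h : IsRegularClosedCurve δ L) {q Q : MvPolynomial (Fin 2) ℂ}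
    (hq : Irreducible q) (hqQ : ∀ s, realPointEval (q * Q) (δ s) = 0) :
    (∀ s, realPointEval q (δ s) = 0) ∨ ∀ s, realPointEval Q (δ s) = 0 := by
  have hmul : ∀ s, realPointEval q (δ s) = 0 ∨ realPointEval Q (δ s) = 0 := fun s => by
    have := hqQ s
    rw [realPointEval, map_mul, mul_eq_zero] at this
    exact this
  by_cases hnd : q ∣ Q
  · right
    obtain ⟨Q', rfl⟩ := hnd
    intro s
    rcases hmul s with h1 | h1
    · rw [realPointEval, map_mul]
      rw [realPointEval] at h1
      rw [h1, zero_mul]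
    · exact h1
  by_contra! hc
  obtain ⟨⟨s₁, hs₁⟩, s₂, hs₂⟩ := hc
  have cq := contDiff_realPointEval h.smooth q
  have cQ := contDiff_realPointEval h.smooth Q
  have oq : IsOpen {s | realPointEval q (δ s) ≠ 0} :=
    isOpen_ne_fun cq.continuous continuous_const
  have oQ : IsOpen {s | realPointEval Q (δ s) ≠ 0} :=
    isOpen_ne_fun cQ.continuous continuous_const
  have fQ : ∀ s ∈ closure {s | realPointEval q (δ s) ≠ 0},
      IsFlatAt (fun s => realPointEval Q (δ s)) s := fun s hs =>
    isFlatAt_of_mem_closure cQ oq (fun t ht => (hmul t).resolve_left ht) hs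
  have fq : ∀ s ∈ closure {s | realPointEval Q (δ s) ≠ 0},
      IsFlatAt (fun s => realPointEval q (δ s)) s := fun s hs =>
    isFlatAt_of_mem_closure cq oQ (fun t ht => (hmul t).resolve_right ht) hs
  have hcover : (Set.univ : Set ℝ) ⊆ closure {s | realPointEval q (δ s) ≠ 0} ∪
      closure {s | realPointEval Q (δ s) ≠ 0} := by
    intro s _
    by_contra hs
    rw [Set.mem_union, not_or] at hs
    -- Off both closures the two factors vanish in a neighbourhood, so they are again both flat.
    have aux : ∀ P : MvPolynomial (Fin 2) ℂ,
        s ∉ closure {s | realPointEval P (δ s) ≠ 0} → IsFlatAt (fun s => realPointEval P (δ s)) s :=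
      fun P hP => isFlatAt_of_mem_closure (contDiff_realPointEval h.smooth P)
        (isClosed_closure.isOpen_compl) (fun t ht => by
          by_contra hne
          exact ht (subset_closure hne)) (subset_closure hP)
    exact h.not_isFlatAt_of_not_dvd hq hnd s (aux q hs.1) (aux Q hs.2)
  obtain ⟨s, -, hs⟩ := isPreconnected_closed_iff.1 (isPreconnected_univ (α := ℝ)) _ _
    isClosed_closure isClosed_closure hcover ⟨s₁, trivial, subset_closure hs₁⟩
    ⟨s₂, trivial, subset_closure hs₂⟩
  exact h.not_isFlatAt_of_not_dvd hq hnd s (fq s hs.2) (fQ s hs.1)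

theorem exists_irreducible_vanish (h : IsRegularClosedCurve δ L) {F : MvPolynomial (Fin 2) ℂ}
    (hF : F ≠ 0) (hFδ : ∀ s, realPointEval F (δ s) = 0) :
    ∃ q : MvPolynomial (Fin 2) ℂ, Irreducible q ∧ ∀ s, realPointEval q (δ s) = 0 := by
  induction F using WfDvdMonoid.induction_on_irreducible with
  | zero => exact absurd rfl hF
  | unit u hu =>
    have := hFδ 0
    exact absurd this (hu.map (MvPolynomial.eval ![((δ 0).re : ℂ), ((δ 0).im : ℂ)])).ne_zero
  | mul a i ha hi ih =>
    rcases h.vanish_or_vanish hi hFδ with h1 | h1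
    · exact ⟨i, hi, h1⟩
    · exact ih ha h1

/-- An algebraic curve has a real defining polynomial that is irreducible over `ℂ`. -/
theorem exists_isDefiningPolynomial (h : IsRegularClosedCurve δ L) {F : MvPolynomial (Fin 2) ℂ}
    (hF : F ≠ 0) (hFδ : ∀ s, realPointEval F (δ s) = 0) : ∃ f, IsDefiningPolynomial δ f := by
  obtain ⟨q, hq, hqδ⟩ := h.exists_irreducible_vanish hF hFδ
  obtain ⟨d, hd⟩ := MvPolynomial.ne_zero_iff.1 hq.ne_zero
  set c := MvPolynomial.coeff d q
  -- One coefficient is normalised to 1. The conjugate polynomial vanishes at the same real points,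
  -- so it is a multiple of p of no larger degree, hence a scalar multiple; comparing the normalised
  -- coefficient shows the scalar is 1.
  set p := MvPolynomial.C c⁻¹ * q with hp
  have hu : IsUnit (MvPolynomial.C c⁻¹ : MvPolynomial (Fin 2) ℂ) :=
    (isUnit_iff_ne_zero.2 (inv_ne_zero hd)).map MvPolynomial.C
  have hpi : Irreducible p := (irreducible_isUnit_mul hu).2 hq
  have hpδ : ∀ s, realPointEval p (δ s) = 0 := fun s => by
    have := hqδ s
    rw [realPointEval] at this
    rw [realPointEval, hp, map_mul, this, mul_zero]
  have hpc : MvPolynomial.coeff d p = 1 := by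
    rw [hp, MvPolynomial.coeff_C_mul, inv_mul_cancel₀ hd]
  clear_value p
  have hbar : ∀ s, realPointEval (MvPolynomial.map (starRingEnd ℂ) p) (δ s) = 0 := by
    intro s
    have h1 : ![((δ s).re : ℂ), ((δ s).im : ℂ)] =
        fun i => starRingEnd ℂ (![((δ s).re : ℂ), ((δ s).im : ℂ)] i) := by
      funext i; fin_cases i <;> simp
    have h2 := MvPolynomial.eval₂_comp_left (starRingEnd ℂ) (RingHom.id ℂ)
      ![((δ s).re : ℂ), ((δ s).im : ℂ)] p
    have h3 := hpδ s
    rw [realPointEval] at h3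
    rw [realPointEval, MvPolynomial.eval_map, h1]
    refine h2.symm.trans ?_
    rw [show MvPolynomial.eval₂ (RingHom.id ℂ) ![((δ s).re : ℂ), ((δ s).im : ℂ)] p = 0 from h3,
      map_zero]
  have hdeg : (MvPolynomial.map (starRingEnd ℂ) p).totalDegree ≤ p.totalDegree :=
    Finset.sup_mono (MvPolynomial.support_map_subset _ _)
  obtain ⟨u, hu⟩ := h.dvd_of_vanish hpi hpδ hbar
  have hbar0 : MvPolynomial.map (starRingEnd ℂ) p ≠ 0 := by
    intro h0
    have := congrArg (MvPolynomial.coeff d) h0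
    rw [MvPolynomial.coeff_map, hpc] at this
    simp at this
  have hu0 : u ≠ 0 := by
    rintro rfl
    exact hbar0 (by rw [hu, mul_zero])
  rw [hu, MvPolynomial.totalDegree_mul_of_isDomain hpi.ne_zero hu0] at hdeg
  rw [MvPolynomial.totalDegree_eq_zero_iff_eq_C.1 (by omega : u.totalDegree = 0)] at hu
  have hv := congrArg (MvPolynomial.coeff d) hu
  rw [MvPolynomial.coeff_map, mul_comm, MvPolynomial.coeff_C_mul, hpc, map_one, mul_one] at hv
  rw [← hv, map_one, mul_one] at hu
  obtain ⟨f, hf⟩ : p ∈ Set.range (MvPolynomial.map (algebraMap ℝ ℂ)) := by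
    rw [MvPolynomial.mem_range_map_iff_coeffs_subset]
    intro z hz
    obtain ⟨k, -, rfl⟩ := MvPolynomial.mem_coeffs_iff.1 hz
    have := congrArg (MvPolynomial.coeff k) hu
    rw [MvPolynomial.coeff_map, Complex.conj_eq_iff_real] at this
    obtain ⟨r, hr⟩ := this
    exact ⟨r, hr.symm⟩
  refine ⟨f, ?_, fun s => ?_⟩
  · rw [complexify, hf]; exact hpi
  · have := hpδ s
    rw [← hf] at this
    have h1 := realPointEval_complexify f (δ s)
    rw [complexify, this] at h1
    exact_mod_cast h1.symm

end IsRegularClosedCurve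

end OuterMagneticBilliard

/-! ### Jets along the tangent circles and the first integral -/

namespace OuterMagneticBilliard

open Filter Topology Asymptotics MvPolynomial

theorem pderiv_zero_pderiv_one (f : MvPolynomial (Fin 2) ℂ) :
    pderiv 0 (pderiv 1 f) = pderiv 1 (pderiv 0 f) := by
  have h : ⁅(pderiv 0 : Derivation ℂ (MvPolynomial (Fin 2) ℂ) (MvPolynomial (Fin 2) ℂ)),
      (pderiv 1 : Derivation ℂ (MvPolynomial (Fin 2) ℂ) (MvPolynomial (Fin 2) ℂ))⁆ = 0 := by
    refine MvPolynomial.derivation_ext fun i => ?_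
    rw [Derivation.commutator_apply]
    fin_cases i <;> simp [pderiv_X]
  have := DFunLike.congr_fun h f
  rw [Derivation.commutator_apply] at this
  exact sub_eq_zero.1 this

/-- A function vanishing to second order is `ε ^ 2` times a function that is differentiable
at `0`. -/
theorem exists_eq_sq_mul {φ φ₁ φ₂ φ₃ : ℝ → ℂ} (hφ : ContDiff ℝ (⊤ : ℕ∞) φ)
    (h₁ : ∀ t, HasDerivAt φ (φ₁ t) t) (h₂ : ∀ t, HasDerivAt φ₁ (φ₂ t) t)
    (h₃ : ∀ t, HasDerivAt φ₂ (φ₃ t) t) (h0 : φ 0 = 0) (h10 : φ₁ 0 = 0) :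
    ∃ u : ℝ → ℂ, (∀ t, φ t = t ^ 2 * u t) ∧ u 0 = φ₂ 0 / 2 ∧ HasDerivAt u (φ₃ 0 / 6) 0 := by
  classical
  refine ⟨fun t => if t = 0 then φ₂ 0 / 2 else φ t / t ^ 2, fun t => ?_, by simp, ?_⟩
  · by_cases ht : t = 0
    · simp [ht, h0]
    · have : (t : ℂ) ≠ 0 := by exact_mod_cast ht
      simp only [ht, if_false]
      field_simp
  · have e1 : deriv φ = φ₁ := funext fun t => (h₁ t).deriv
    have e2 : deriv φ₁ = φ₂ := funext fun t => (h₂ t).deriv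
    have e3 : deriv φ₂ = φ₃ := funext fun t => (h₃ t).deriv
    have ht := taylor_isLittleO_univ (x₀ := 0) (n := 3)
      (contDiff_infty.1 hφ 3)
    have hT : ∀ x : ℝ, taylorWithinEval φ 3 Set.univ 0 x
        = x ^ 2 * (φ₂ 0 / 2 + x * (φ₃ 0 / 6)) := by
      intro x
      rw [taylor_within_apply]
      simp only [iteratedDerivWithin_univ, Finset.sum_range_succ, Finset.sum_range_zero,
        iteratedDeriv_succ, iteratedDeriv_zero, e1, e2, e3, h0, h10,
        Complex.real_smul, Nat.factorial, sub_zero]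
      push_cast
      ring
    simp only [hT, sub_zero] at ht
    rw [hasDerivAt_iff_isLittleO]
    have h4 : (fun x : ℝ => ((if x = 0 then φ₂ 0 / 2 else φ x / x ^ 2)
        - (if (0 : ℝ) = 0 then φ₂ 0 / 2 else φ 0 / (0 : ℝ) ^ 2)) - (x - 0) • (φ₃ 0 / 6))
        = fun x : ℝ => (x ^ 2 : ℝ)⁻¹ • (φ x - x ^ 2 * (φ₂ 0 / 2 + x * (φ₃ 0 / 6))) := by
      funext x
      by_cases hx : x = 0
      · simp [hx]
      · have : (x : ℂ) ≠ 0 := by exact_mod_cast hx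
        simp only [hx, if_false, if_true, sub_zero, Complex.real_smul]
        push_cast
        field_simp
        ring
    have h5 := (isBigO_refl (fun x : ℝ => (x ^ 2 : ℝ)⁻¹) (𝓝 0)).smul_isLittleO ht
    rw [← h4] at h5
    refine h5.trans_isBigO (isBigO_of_le _ fun x => ?_)
    by_cases hx : x = 0
    · simp [hx]
    · rw [smul_eq_mul, sub_zero]
      apply le_of_eq
      congr 1
      field_simp

theorem deriv_eq_zero_of_even {h : ℝ → ℂ} {h' : ℂ} (hd : HasDerivAt h h' 0) {a : ℝ} (ha : 0 < a)
    (he : ∀ t, 0 < t → t < a → h (-t) = h t) : h' = 0 := by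
  have hn : HasDerivAt (fun t => h (-t)) (-h') 0 := by
    have h1 : HasDerivAt h h' (-0) := by rwa [neg_zero]
    convert! h1.scomp (0 : ℝ) (hasDerivAt_neg (0 : ℝ)) using 1
    simp
  have heq : (fun t => h (-t)) =ᶠ[𝓝 0] h := by
    filter_upwards [Ioo_mem_nhds (neg_lt_zero.2 ha) ha] with t ht
    rcases lt_trichotomy t 0 with h1 | h1 | h1
    · have := he (-t) (by linarith) (by linarith [ht.1])
      rw [neg_neg] at this
      exact this.symm
    · simp [h1]
    · exact he t h1 ht.2
  have := hn.unique (hd.congr_of_eventuallyEq heq)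
  linear_combination (-1 / 2 : ℂ) * this

/-- The point at angle `ε` from `δ s` on the circle of radius `r` that is tangent at `δ s` to the
oriented line directed by the unit vector `v s`. -/
noncomputable def circlePoint (δ v : ℝ → ℂ) (r s ε : ℝ) : ℂ :=
  δ s + r * (Complex.I * v s) - Complex.exp (ε * Complex.I) * (r * (Complex.I * v s))

/-- A regular closed curve `δ` with unit tangent field `v`, `δ' = lam • v` and `v' = kap • J v`,
whose tangent circles of radius `r` are nowhere osculating. -/
structure IsTangentCircleFrame (δ v : ℝ → ℂ) (lam kap : ℝ → ℝ) (r L : ℝ) : Prop where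
  curve : IsRegularClosedCurve δ L
  norm_v : ∀ s, ‖v s‖ = 1
  hasDerivAt_curve : ∀ s, HasDerivAt δ (lam s * v s) s
  hasDerivAt_v : ∀ s, HasDerivAt v (kap s * (Complex.I * v s)) s
  lam_ne : ∀ s, lam s ≠ 0
  contact : ∀ s, r * kap s ≠ lam s
  radius_pos : 0 < r

/-- `F` is invariant under the reflection of each tangent circle in the normal line. -/
def IsReflectionInvariant (δ v : ℝ → ℂ) (r : ℝ) (F : MvPolynomial (Fin 2) ℂ) : Prop :=
  ∀ s ε, 0 < ε → ε < Real.pi →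
    realPointEval F (circlePoint δ v r s (-ε)) = realPointEval F (circlePoint δ v r s ε)

theorem circlePoint_zero (δ v : ℝ → ℂ) (r s : ℝ) : circlePoint δ v r s 0 = δ s := by
  simp [circlePoint]

theorem contDiff_circlePoint (δ v : ℝ → ℂ) (r s : ℝ) :
    ContDiff ℝ (⊤ : ℕ∞) (circlePoint δ v r s) := by
  have h : ContDiff ℝ (⊤ : ℕ∞) fun ε : ℝ => (ε : ℂ) := Complex.ofRealCLM.contDiff
  unfold circlePoint
  exact contDiff_const.sub ((h.mul contDiff_const).cexp.mul contDiff_const)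

theorem hasDerivAt_circleTangent (v : ℝ → ℂ) (r s t : ℝ) :
    HasDerivAt (fun ε : ℝ => Complex.exp (ε * Complex.I) * (r * v s))
      (Complex.I * (Complex.exp (t * Complex.I) * (r * v s))) t := by
  have h : HasDerivAt (fun ε : ℝ => (ε : ℂ)) 1 t := Complex.ofRealCLM.hasDerivAt
  have := ((h.mul_const Complex.I).cexp).mul_const (r * v s)
  convert! this using 1
  ring

theorem hasDerivAt_circlePoint (δ v : ℝ → ℂ) (r s t : ℝ) :
    HasDerivAt (circlePoint δ v r s) (Complex.exp (t * Complex.I) * (r * v s)) t := by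
  have h := (hasDerivAt_circleTangent v r s t).const_mul Complex.I
  have h1 := h.const_sub (δ s + r * (Complex.I * v s))
  convert! h1 using 1
  · funext ε
    simp only [circlePoint]
    ring
  · linear_combination ((Complex.exp (t * Complex.I) * (r * v s))) * Complex.I_mul_I

theorem hasDerivAt_ofReal_re {p : ℝ → ℂ} {p' : ℂ} {t : ℝ} (hp : HasDerivAt p p' t) :
    HasDerivAt (fun t => ((p t).re : ℂ)) (p'.re : ℂ) t :=
  (Complex.ofRealCLM.comp Complex.reCLM).hasFDerivAt.comp_hasDerivAt t hp

theorem hasDerivAt_ofReal_im {p : ℝ → ℂ} {p' : ℂ} {t : ℝ} (hp : HasDerivAt p p' t) :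
    HasDerivAt (fun t => ((p t).im : ℂ)) (p'.im : ℂ) t :=
  (Complex.ofRealCLM.comp Complex.imCLM).hasFDerivAt.comp_hasDerivAt t hp

/-- The second derivative of `f` at a real point along the plane vectors `w`, `z`. -/
noncomputable def dirDeriv₂ (f : MvPolynomial (Fin 2) ℂ) (p w z : ℂ) : ℂ :=
  dirDeriv (pderiv 0 f) p z * w.re + dirDeriv (pderiv 1 f) p z * w.im

/-- The third derivative of `f` at a real point along the plane vectors `w`, `z`, `y`. -/
noncomputable def dirDeriv₃ (f : MvPolynomial (Fin 2) ℂ) (p w z y : ℂ) : ℂ :=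
  dirDeriv₂ (pderiv 0 f) p z y * w.re + dirDeriv₂ (pderiv 1 f) p z y * w.im

theorem dirDeriv₂_comm (f : MvPolynomial (Fin 2) ℂ) (p w z : ℂ) :
    dirDeriv₂ f p w z = dirDeriv₂ f p z w := by
  simp only [dirDeriv₂, dirDeriv, pderiv_zero_pderiv_one]
  ring

theorem hasDerivAt_dirDeriv {p w : ℝ → ℂ} {p' w' : ℂ} {t : ℝ} (hp : HasDerivAt p p' t)
    (hw : HasDerivAt w w' t) (f : MvPolynomial (Fin 2) ℂ) :
    HasDerivAt (fun t => dirDeriv f (p t) (w t))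
      (dirDeriv₂ f (p t) (w t) p' + dirDeriv f (p t) w') t := by
  have h := ((hasDerivAt_realPointEval hp (pderiv 0 f)).mul (hasDerivAt_ofReal_re hw)).add
    ((hasDerivAt_realPointEval hp (pderiv 1 f)).mul (hasDerivAt_ofReal_im hw))
  convert! h using 1
  simp only [dirDeriv₂, dirDeriv]
  ring

theorem hasDerivAt_dirDeriv₂ {p w z : ℝ → ℂ} {p' w' z' : ℂ} {t : ℝ} (hp : HasDerivAt p p' t)
    (hw : HasDerivAt w w' t) (hz : HasDerivAt z z' t) (f : MvPolynomial (Fin 2) ℂ) :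
    HasDerivAt (fun t => dirDeriv₂ f (p t) (w t) (z t))
      (dirDeriv₃ f (p t) (w t) (z t) p' + dirDeriv₂ f (p t) w' (z t)
        + dirDeriv₂ f (p t) (w t) z') t := by
  have h := ((hasDerivAt_dirDeriv hp hz (pderiv 0 f)).mul (hasDerivAt_ofReal_re hw)).add
    ((hasDerivAt_dirDeriv hp hz (pderiv 1 f)).mul (hasDerivAt_ofReal_im hw))
  convert! h using 1
  simp only [dirDeriv₃, dirDeriv₂]
  ring

theorem dirDeriv_real_mul (f : MvPolynomial (Fin 2) ℂ) (p w : ℂ) (a : ℝ) :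
    dirDeriv f p (a * w) = a * dirDeriv f p w := by
  simp [dirDeriv]
  ring

theorem dirDeriv_I_mul_I_mul (f : MvPolynomial (Fin 2) ℂ) (p w : ℂ) :
    dirDeriv f p (Complex.I * (Complex.I * w)) = - dirDeriv f p w := by
  simp [dirDeriv]
  ring

theorem dirDeriv₂_real_mul_left (f : MvPolynomial (Fin 2) ℂ) (p w z : ℂ) (a : ℝ) :
    dirDeriv₂ f p (a * w) z = a * dirDeriv₂ f p w z := by
  simp [dirDeriv₂]
  ring

theorem dirDeriv₂_real_mul_right (f : MvPolynomial (Fin 2) ℂ) (p w z : ℂ) (a : ℝ) :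
    dirDeriv₂ f p w (a * z) = a * dirDeriv₂ f p w z := by
  rw [dirDeriv₂_comm, dirDeriv₂_real_mul_left, dirDeriv₂_comm]

theorem dirDeriv₃_real_mul_right (f : MvPolynomial (Fin 2) ℂ) (p w z y : ℂ) (a : ℝ) :
    dirDeriv₃ f p w z (a * y) = a * dirDeriv₃ f p w z y := by
  simp only [dirDeriv₃, dirDeriv₂_real_mul_right]
  ring

theorem dirDeriv₃_real_mul (f : MvPolynomial (Fin 2) ℂ) (p w : ℂ) (a : ℝ) :
    dirDeriv₃ f p (a * w) (a * w) (a * w) = a ^ 3 * dirDeriv₃ f p w w w := by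
  simp only [dirDeriv₃, dirDeriv₂_real_mul_right, dirDeriv₂_real_mul_left, Complex.re_ofReal_mul,
    Complex.im_ofReal_mul]
  push_cast
  ring

namespace IsTangentCircleFrame

variable {δ v : ℝ → ℂ} {lam kap : ℝ → ℝ} {r L : ℝ}

theorem re_sq_add_im_sq (h : IsTangentCircleFrame δ v lam kap r L) (s : ℝ) :
    ((v s).re : ℂ) ^ 2 + ((v s).im : ℂ) ^ 2 = 1 := by
  have h1 := h.norm_v s
  have h2 : (v s).re ^ 2 + (v s).im ^ 2 = 1 := by
    have := Complex.sq_norm (v s)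
    rw [h1, Complex.normSq_apply] at this
    linarith
  exact_mod_cast h2

/-- F is even in ε, so its derivative at ε = 0 vanishes; this is its derivative along v, the
direction tangent to δ. -/
theorem exists_const (h : IsTangentCircleFrame δ v lam kap r L) {F : MvPolynomial (Fin 2) ℂ}
    (hF : IsReflectionInvariant δ v r F) : ∃ c, ∀ s, realPointEval F (δ s) = c := by
  have h1 : ∀ s, dirDeriv F (δ s) (v s) = 0 := by
    intro s
    have h2 := hasDerivAt_realPointEval (hasDerivAt_circlePoint δ v r s 0) F
    have h3 := deriv_eq_zero_of_even h2 Real.pi_pos (hF s)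
    simp only [circlePoint_zero, Complex.ofReal_zero, zero_mul, Complex.exp_zero, one_mul,
      dirDeriv_real_mul] at h3
    exact (mul_eq_zero.1 h3).resolve_left (by exact_mod_cast h.radius_pos.ne')
  have h4 : ∀ s, HasDerivAt (fun s => realPointEval F (δ s)) 0 s := fun s => by
    have := hasDerivAt_realPointEval (h.hasDerivAt_curve s) F
    rwa [dirDeriv_real_mul, h1, mul_zero] at this
  exact ⟨_, fun s => is_const_of_deriv_eq_zero (fun s => (h4 s).differentiableAt)
    (fun s => (h4 s).deriv) s 0⟩

theorem dirDeriv_tangent (h : IsTangentCircleFrame δ v lam kap r L) {f : MvPolynomial (Fin 2) ℂ}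
    (hf : ∀ s, realPointEval f (δ s) = 0) (s : ℝ) : dirDeriv f (δ s) (v s) = 0 := by
  have h1 := hasDerivAt_realPointEval (h.hasDerivAt_curve s) f
  simp only [hf] at h1
  have h2 := h1.unique (hasDerivAt_const s 0)
  rw [dirDeriv_real_mul] at h2
  exact (mul_eq_zero.1 h2).resolve_left (by exact_mod_cast h.lam_ne s)

/-- This is the identity f_v = 0 differentiated along δ; it expresses the curvature of δ through the
2-jet of f. -/
theorem dirDeriv₂_tangent (h : IsTangentCircleFrame δ v lam kap r L)
    {f : MvPolynomial (Fin 2) ℂ} (hf : ∀ s, realPointEval f (δ s) = 0) (s : ℝ) :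
    lam s * dirDeriv₂ f (δ s) (v s) (v s) + kap s * dirDeriv f (δ s) (Complex.I * v s) = 0 := by
  have h1 := hasDerivAt_dirDeriv (h.hasDerivAt_curve s) (h.hasDerivAt_v s) f
  simp only [h.dirDeriv_tangent hf] at h1
  have h2 := h1.unique (hasDerivAt_const s 0)
  rwa [dirDeriv₂_real_mul_right, dirDeriv_real_mul] at h2

/-- The condition imposed by invariance on the third order jet along the tangent circle. -/
theorem third_order (h : IsTangentCircleFrame δ v lam kap r L) {f g F : MvPolynomial (Fin 2) ℂ}
    (hf : ∀ s, realPointEval f (δ s) = 0) {m : ℕ} (hmpos : 0 < m) {c : ℂ}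
    (hfg : F = C c + f ^ m * g)
    (hF : IsReflectionInvariant δ v r F) (s : ℝ) :
    (r * dirDeriv₂ f (δ s) (v s) (v s) + dirDeriv f (δ s) (Complex.I * v s)) ^ (m - 1) *
      (m * (r * dirDeriv₃ f (δ s) (v s) (v s) (v s)
          + 3 * dirDeriv₂ f (δ s) (v s) (Complex.I * v s)) * realPointEval g (δ s)
        + 3 * (r * dirDeriv₂ f (δ s) (v s) (v s) + dirDeriv f (δ s) (Complex.I * v s))
          * dirDeriv g (δ s) (v s)) = 0 := by
  set p := circlePoint δ v r s with hp
  set w : ℝ → ℂ := fun ε => Complex.exp (ε * Complex.I) * (r * v s) with hw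
  have dp : ∀ t, HasDerivAt p (w t) t := fun t => hasDerivAt_circlePoint δ v r s t
  have dw : ∀ t, HasDerivAt w (Complex.I * w t) t := fun t => hasDerivAt_circleTangent v r s t
  have dJw : ∀ t, HasDerivAt (fun t => Complex.I * w t) (Complex.I * (Complex.I * w t)) t :=
    fun t => (dw t).const_mul _
  have p0 : p 0 = δ s := circlePoint_zero δ v r s
  have w0 : w 0 = r * v s := by simp [hw]
  have h1 : ∀ t, HasDerivAt (fun t => realPointEval f (p t)) (dirDeriv f (p t) (w t)) t :=
    fun t => hasDerivAt_realPointEval (dp t) f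
  have h2 := fun t => hasDerivAt_dirDeriv (dp t) (dw t) f
  have h3 := fun t => (hasDerivAt_dirDeriv₂ (dp t) (dw t) (dw t) f).add
    (hasDerivAt_dirDeriv (dp t) (dJw t) f)
  obtain ⟨u, hu, hu0, hu'⟩ := exists_eq_sq_mul
    (contDiff_realPointEval (contDiff_circlePoint δ v r s) f) h1 h2 h3
    (by rw [← hp, p0, hf]) (by rw [p0, w0, dirDeriv_real_mul, h.dirDeriv_tangent hf, mul_zero])
  have hg := hasDerivAt_realPointEval (dp 0) g
  have hprod := (hu'.pow m).mul hg
  have heven := deriv_eq_zero_of_even hprod Real.pi_pos (fun t ht htp => by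
    have h4 := hF s t ht htp
    -- Along the circle f = t^2 u, so F - c is the even power t^(2m) times u^m g. Evenness of F
    -- passes to u^m g, whose derivative at 0 must vanish.
    have h5 : ∀ t, realPointEval F (p t) =
        c + (t : ℂ) ^ (2 * m) * (u t ^ m * realPointEval g (p t)) := by
      intro t
      have h6 := hu t
      have : realPointEval F (p t) = c + realPointEval f (p t) ^ m * realPointEval g (p t) := by
        rw [hfg]; simp [realPointEval]
      rw [this, h6]
      ring
    rw [← hp, h5, h5] at h4
    have h7 : ((t : ℂ)) ^ (2 * m) ≠ 0 := pow_ne_zero _ (by exact_mod_cast ht.ne')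
    have h8 : (((-t : ℝ) : ℂ)) ^ (2 * m) = (t : ℂ) ^ (2 * m) := by
      rw [pow_mul, pow_mul]; congr 1; push_cast; ring
    rw [h8] at h4
    exact mul_left_cancel₀ h7 (add_left_cancel h4))
  have hr : (r : ℂ) ≠ 0 := by exact_mod_cast h.radius_pos.ne'
  have hA : u 0 = r / 2 * (r * dirDeriv₂ f (δ s) (v s) (v s)
      + dirDeriv f (δ s) (Complex.I * v s)) := by
    rw [hu0, p0, w0, dirDeriv₂_real_mul_right, dirDeriv₂_real_mul_left, mul_left_comm Complex.I,
      dirDeriv_real_mul]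
    ring
  have hpow : u 0 ^ m = u 0 ^ (m - 1) * u 0 := by rw [← pow_succ, Nat.sub_add_cancel hmpos]
  rw [Pi.pow_apply, hpow] at heven
  simp only [p0, w0, mul_left_comm Complex.I, dirDeriv₂_real_mul_right, dirDeriv₂_real_mul_left,
    dirDeriv₃_real_mul, dirDeriv_real_mul, dirDeriv_I_mul_I_mul, h.dirDeriv_tangent hf,
    dirDeriv₂_comm f _ (Complex.I * v s) (v s), hA, mul_pow] at heven
  -- The common factor of the expanded derivative: (r/2)^(m-1) comes from u(0)^(m-1), and r^2/6 from
  -- u'(0) = r^2 (r f_vvv + 3 f_vJv) / 6.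
  have hr2 : ((r : ℂ) / 2) ^ (m - 1) * (r ^ 2 / 6) ≠ 0 := by
    apply mul_ne_zero
    · exact pow_ne_zero _ (by simpa using hr)
    · simpa using hr
  apply mul_left_cancel₀ hr2
  rw [mul_zero, ← heven]
  ring


/-- A first integral of the invariance condition along the curve. -/
theorem exists_curvature_integral (h : IsTangentCircleFrame δ v lam kap r L)
    {f g F : MvPolynomial (Fin 2) ℂ} (hf : ∀ s, realPointEval f (δ s) = 0) {m : ℕ}
    (hmpos : 0 < m) {c : ℂ} (hfg : F = C c + f ^ m * g) (hF : IsReflectionInvariant δ v r F) :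
    ∃ K, ∀ s, realPointEval g (δ s) ^ 3 * (dirDeriv f (δ s) (Complex.I * v s) ^ 2 *
      (r * dirDeriv₂ f (δ s) (v s) (v s) + dirDeriv f (δ s) (Complex.I * v s))) ^ m = K := by
  have hd : ∀ s, HasDerivAt (fun s => realPointEval g (δ s) ^ 3 *
      (dirDeriv f (δ s) (Complex.I * v s) ^ 2 *
      (r * dirDeriv₂ f (δ s) (v s) (v s) + dirDeriv f (δ s) (Complex.I * v s))) ^ m) 0 s := by
    intro s
    have dδ := h.hasDerivAt_curve s
    have dv := h.hasDerivAt_v s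
    have dg := hasDerivAt_realPointEval dδ g
    have dρ := hasDerivAt_dirDeriv dδ (dv.const_mul Complex.I) f
    have dB := hasDerivAt_dirDeriv₂ dδ dv dv f
    have e1 := h.dirDeriv₂_tangent hf s
    have e2 := h.third_order hf hmpos hfg hF s
    have hd := (dg.pow 3).mul ((((dρ.pow 2).mul ((dB.const_mul (r : ℂ)).add dρ))).pow m)
    convert! hd using 1
    simp only [Pi.mul_apply, Pi.add_apply, Pi.pow_apply, dirDeriv_real_mul, mul_left_comm Complex.I,
      dirDeriv₂_real_mul_right, dirDeriv₂_real_mul_left, dirDeriv₃_real_mul_right,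
      dirDeriv_I_mul_I_mul, h.dirDeriv_tangent hf, dirDeriv₂_comm f _ (Complex.I * v s) (v s)]
    obtain ⟨n, rfl⟩ : ∃ n, m = n + 1 := ⟨m - 1, by omega⟩
    simp only [Nat.add_sub_cancel] at e2 ⊢
    set ρ := dirDeriv f (δ s) (Complex.I * v s)
    set B := dirDeriv₂ f (δ s) (v s) (v s)
    set M := dirDeriv₂ f (δ s) (v s) (Complex.I * v s)
    set T := dirDeriv₃ f (δ s) (v s) (v s) (v s)
    set G := realPointEval g (δ s)
    set G' := dirDeriv g (δ s) (v s)
    simp only [mul_pow]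
    push_cast at e2 ⊢
    -- Here ρ' = lam M and B' = lam T + 2 kap M. The curvature relation `e1` removes kap; the rest
    -- is lam G^2 ρ^(2m) times the third order condition `e2`.
    linear_combination (-(G ^ 2 * (ρ ^ 2) ^ (n + 1) * (lam s : ℂ))) * e2
      - ((n + 1) * G ^ 3 * (ρ ^ 2) ^ n * (r * B + ρ) ^ n * (2 * ρ * M * r)) * e1
  exact ⟨_, fun s => is_const_of_deriv_eq_zero (fun s => (hd s).differentiableAt)
    (fun s => (hd s).deriv) s 0⟩

end IsTangentCircleFrame

/-! ### Smoothness of the affine complex curve -/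

/-- The squared gradient of a polynomial. -/
noncomputable def gradSq (f : MvPolynomial (Fin 2) ℂ) : MvPolynomial (Fin 2) ℂ :=
  pderiv 0 f ^ 2 + pderiv 1 f ^ 2

/-- The Hessian of a polynomial in the direction of the level curve. -/
noncomputable def tangentHessian (f : MvPolynomial (Fin 2) ℂ) : MvPolynomial (Fin 2) ℂ :=
  pderiv 0 (pderiv 0 f) * pderiv 1 f ^ 2 - 2 * pderiv 1 (pderiv 0 f) * pderiv 0 f * pderiv 1 f +
    pderiv 1 (pderiv 1 f) * pderiv 0 f ^ 2

/-- Powers are reduced with ρ^2 = Q. The exponent is m + 1 because the zeroth power would give X =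
1, which does not vanish where H and Q do. -/
theorem exists_pow_eq_add_mul_sqrt (r : ℂ) (H Q : MvPolynomial (Fin 2) ℂ) (m : ℕ) :
    ∃ X Y : MvPolynomial (Fin 2) ℂ,
      (∀ p ρ, ρ ^ 2 = eval p Q →
        (r * eval p H + eval p Q * ρ) ^ (m + 1) = eval p X + eval p Y * ρ) ∧
      ∀ p, eval p H = 0 → eval p Q = 0 → eval p X = 0 ∧ eval p Y = 0 := by
  induction m with
  | zero =>
    exact ⟨C r * H, Q, fun p ρ _ => by simp, fun p h1 h2 => by simp [h1, h2]⟩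
  | succ m ih =>
    obtain ⟨X, Y, h1, h2⟩ := ih
    refine ⟨C r * H * X + Q ^ 2 * Y, C r * H * Y + Q * X, fun p ρ hρ => ?_, fun p hH hQ => ?_⟩
    · rw [pow_succ, h1 p ρ hρ]
      simp only [map_add, map_mul, map_pow, eval_C]
      linear_combination (eval p Y * eval p Q) * hρ
    · simp [hH, hQ]

theorem totalDegree_pderiv_le (f : MvPolynomial (Fin 2) ℂ) (i : Fin 2) :
    (pderiv i f).totalDegree ≤ f.totalDegree - 1 := by
  conv_lhs => rw [f.as_sum, map_sum]
  refine totalDegree_finsetSum_le fun d hd => ?_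
  rw [pderiv_monomial]
  by_cases hi : d i = 0
  · simp [hi]
  · refine (totalDegree_monomial_le _ _).trans ?_
    have h1 : Finsupp.single i 1 ≤ d := by
      simpa [Finsupp.single_le_iff] using Nat.one_le_iff_ne_zero.2 hi
    have h2 := le_totalDegree hd
    have h3 : d.degree = (d - Finsupp.single i 1).degree + 1 := by
      conv_lhs => rw [← tsub_add_cancel_of_le h1]
      simp
    change (d - Finsupp.single i 1).degree ≤ _
    change d.degree ≤ _ at h2
    omega

/-- Differentiation lowers the degree, so divisibility would force f to be constant and its
derivative zero. -/
theorem not_dvd_pderiv {f : MvPolynomial (Fin 2) ℂ} {i : Fin 2} (h0 : pderiv i f ≠ 0) :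
    ¬ f ∣ pderiv i f := by
  rintro ⟨g, hg⟩
  have hf0 : f ≠ 0 := by rintro rfl; simp at h0
  have hg0 : g ≠ 0 := by rintro rfl; exact h0 (by rw [hg, mul_zero])
  have h1 := totalDegree_pderiv_le f i
  rw [hg, totalDegree_mul_of_isDomain hf0 hg0] at h1
  have h2 : f.totalDegree = 0 := by omega
  rw [totalDegree_eq_zero_iff_eq_C.1 h2] at h0
  simp at h0

theorem eq_C_of_pderiv_eq_zero {f : MvPolynomial (Fin 2) ℂ} (h : ∀ i, pderiv i f = 0) :
    f = C (eval 0 f) := by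
  refine MvPolynomial.funext fun p => ?_
  have hd : ∀ t : ℝ, HasDerivAt (fun t : ℝ => eval (fun i => (t : ℂ) * p i) f) 0 t := fun t => by
    have hx : ∀ i, HasDerivAt (fun t : ℝ => (t : ℂ) * p i) (p i) t := fun i => by
      have h1 : HasDerivAt (fun ε : ℝ => (ε : ℂ)) 1 t := Complex.ofRealCLM.hasDerivAt
      simpa using h1.mul_const (p i)
    have := hasDerivAt_eval_mvPolynomial (x := fun t : ℝ => fun i => (t : ℂ) * p i) hx f
    simpa [h] using this
  have := is_const_of_deriv_eq_zero (fun s => (hd s).differentiableAt) (fun s => (hd s).deriv) 1 0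
  simpa using this

theorem exists_pderiv_ne_zero {f : MvPolynomial (Fin 2) ℂ} (hf : Irreducible f) :
    ∃ i, pderiv i f ≠ 0 := by
  by_contra! h
  have h1 := eq_C_of_pderiv_eq_zero h
  have h2 := hf.ne_zero
  rw [h1] at h2
  apply hf.not_isUnit
  rw [h1]
  exact (isUnit_iff_ne_zero.2 fun h3 => h2 (by rw [h3, map_zero])).map C

namespace IsTangentCircleFrame

variable {δ v : ℝ → ℂ} {lam kap : ℝ → ℝ} {r L : ℝ}

theorem pderiv_zero_eq (h : IsTangentCircleFrame δ v lam kap r L) {f : MvPolynomial (Fin 2) ℂ}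
    (hf : ∀ s, realPointEval f (δ s) = 0) (s : ℝ) : realPointEval (pderiv 0 f) (δ s) =
      - (dirDeriv f (δ s) (Complex.I * v s) * (v s).im) := by
  have e1 := h.dirDeriv_tangent hf s
  have e2 := h.re_sq_add_im_sq s
  simp only [dirDeriv, Complex.mul_re, Complex.mul_im, Complex.I_re, Complex.I_im, zero_mul,
    one_mul, zero_sub, zero_add] at e1 ⊢
  push_cast
  linear_combination ((v s).re : ℂ) * e1 - realPointEval (pderiv 0 f) (δ s) * e2

theorem pderiv_one_eq (h : IsTangentCircleFrame δ v lam kap r L) {f : MvPolynomial (Fin 2) ℂ}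
    (hf : ∀ s, realPointEval f (δ s) = 0) (s : ℝ) : realPointEval (pderiv 1 f) (δ s) =
      dirDeriv f (δ s) (Complex.I * v s) * (v s).re := by
  have e1 := h.dirDeriv_tangent hf s
  have e2 := h.re_sq_add_im_sq s
  simp only [dirDeriv, Complex.mul_re, Complex.mul_im, Complex.I_re, Complex.I_im, zero_mul,
    one_mul, zero_sub, zero_add] at e1 ⊢
  push_cast
  linear_combination ((v s).im : ℂ) * e1 - realPointEval (pderiv 1 f) (δ s) * e2

theorem gradSq_eq (h : IsTangentCircleFrame δ v lam kap r L) {f : MvPolynomial (Fin 2) ℂ}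
    (hf : ∀ s, realPointEval f (δ s) = 0) (s : ℝ) :
    realPointEval (gradSq f) (δ s) = dirDeriv f (δ s) (Complex.I * v s) ^ 2 := by
  have e1 := h.pderiv_zero_eq hf s
  have e2 := h.pderiv_one_eq hf s
  simp only [realPointEval] at e1 e2
  rw [realPointEval, gradSq, map_add, map_pow, map_pow, e1, e2]
  linear_combination (dirDeriv f (δ s) (Complex.I * v s) ^ 2) * h.re_sq_add_im_sq s

theorem isSmoothAffineCurve (h : IsTangentCircleFrame δ v lam kap r L)
    {f F : MvPolynomial (Fin 2) ℂ} (hf : Irreducible f) (hfδ : ∀ s, realPointEval f (δ s) = 0)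
    (hFc : ∀ c, F ≠ C c) (hF : IsReflectionInvariant δ v r F) : IsSmoothAffineCurve f := by
  obtain ⟨c, hc⟩ := h.exists_const hF
  have hne : F - C c ≠ 0 := sub_ne_zero.2 (hFc c)
  obtain ⟨m, g, hg, hfg⟩ := WfDvdMonoid.max_power_factor hne hf
  have hdvd : f ∣ F - C c := h.curve.dvd_of_vanish hf hfδ fun s => by
    have := hc s
    rw [realPointEval] at this
    rw [realPointEval, map_sub, this, eval_C, sub_self]
  have hm : 0 < m := by
    rcases Nat.eq_zero_or_pos m with rfl | hm
    · rw [pow_zero, one_mul] at hfg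
      exact absurd (hfg ▸ hdvd) hg
    · exact hm
  have hFe : F = C c + f ^ m * g := by rw [← hfg]; ring
  obtain ⟨K, hK⟩ := h.exists_curvature_integral hfδ hm hFe hF
  have hfx := h.pderiv_zero_eq hfδ
  have hfy := h.pderiv_one_eq hfδ
  have hQ := h.gradSq_eq hfδ
  have hH : ∀ s, realPointEval (tangentHessian f) (δ s) =
      dirDeriv f (δ s) (Complex.I * v s) ^ 2 * dirDeriv₂ f (δ s) (v s) (v s) := by
    intro s
    have e1 := hfx s
    have e2 := hfy s
    simp only [realPointEval] at e1 e2
    have e3 : dirDeriv₂ f (δ s) (v s) (v s) = realPointEval (pderiv 0 (pderiv 0 f)) (δ s)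
        * (v s).re ^ 2 + 2 * realPointEval (pderiv 1 (pderiv 0 f)) (δ s) * (v s).re * (v s).im
        + realPointEval (pderiv 1 (pderiv 1 f)) (δ s) * (v s).im ^ 2 := by
      simp only [dirDeriv₂, dirDeriv, pderiv_zero_pderiv_one]
      ring
    rw [e3]
    simp only [realPointEval, tangentHessian, map_add, map_sub, map_mul, map_pow, e1, e2,
      map_ofNat]
    ring
  -- If K = 0, then at each point of δ either g = 0, or ρ = 0, or rB + ρ = 0. With the curvature
  -- relation the last gives (lam - r kap) ρ = 0, so again ρ = 0 by non-osculation. Thus g ∇f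
  -- vanishes on δ, and the prime f divides g or a nonzero partial derivative of f, both impossible.
  have hK0 : K ≠ 0 := by
    rintro rfl
    have hz : ∀ s, realPointEval g (δ s) = 0 ∨ dirDeriv f (δ s) (Complex.I * v s) = 0 := by
      intro s
      rcases mul_eq_zero.1 (hK s) with h1 | h1
      · exact Or.inl (pow_eq_zero_iff (by norm_num) |>.1 h1)
      · right
        by_contra hρ
        have h2 := (mul_eq_zero.1 ((pow_eq_zero_iff hm.ne').1 h1)).resolve_left
          (pow_ne_zero 2 hρ)
        have h3 := h.dirDeriv₂_tangent hfδ s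
        have h4 : ((lam s : ℂ) - r * kap s) * dirDeriv f (δ s) (Complex.I * v s) = 0 := by
          linear_combination (lam s : ℂ) * h2 - (r : ℂ) * h3
        rcases mul_eq_zero.1 h4 with h5 | h5
        · apply h.contact s
          have : (lam s : ℂ) = ((r * kap s : ℝ) : ℂ) := by
            push_cast; linear_combination h5
          exact (Complex.ofReal_injective this).symm
        · exact hρ h5
    obtain ⟨i, hi⟩ := exists_pderiv_ne_zero hf
    have h1 : f ∣ g * pderiv i f := h.curve.dvd_of_vanish hf hfδ fun s => by
      rw [realPointEval, map_mul]
      rcases hz s with h1 | h1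
      · rw [realPointEval] at h1
        rw [h1, zero_mul]
      · have e1 := hfx s
        have e2 := hfy s
        rw [h1, zero_mul] at e1 e2
        rw [neg_zero] at e1
        rw [realPointEval] at e1 e2
        fin_cases i
        · simp only [Fin.zero_eta, e1, mul_zero]
        · simp only [Fin.mk_one, e2, mul_zero]
    rcases hf.prime.dvd_or_dvd h1 with h2 | h2
    · exact hg h2
    · exact not_dvd_pderiv hi h2
  intro p hp
  by_contra! hsing
  obtain ⟨X, Y, hXY, hXY0⟩ := exists_pow_eq_add_mul_sqrt r (tangentHessian f) (gradSq f) (m - 1)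
  rw [Nat.sub_add_cancel hm] at hXY
  obtain ⟨hX, hY⟩ := hXY0 p (by simp [tangentHessian, hsing]) (by simp [gradSq, hsing])
  -- On δ the first integral reads K = g^3 (X + Yρ). Isolating ρ and squaring leaves a polynomial
  -- identity, which extends to all complex zeros of f.
  have hdiv : f ∣ (C K - g ^ 3 * X) ^ 2 - g ^ 6 * Y ^ 2 * gradSq f :=
    h.curve.dvd_of_vanish hf hfδ fun s => by
      have e := hXY _ (dirDeriv f (δ s) (Complex.I * v s)) (hQ s).symm
      have e1 := hK s
      have e2 := hQ s
      have e3 := hH s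
      simp only [realPointEval] at e e1 e2 e3 ⊢
      rw [e3, e2] at e
      rw [show (r : ℂ) * (dirDeriv f (δ s) (Complex.I * v s) ^ 2 * dirDeriv₂ f (δ s) (v s) (v s)) +
        dirDeriv f (δ s) (Complex.I * v s) ^ 2 * dirDeriv f (δ s) (Complex.I * v s) =
        dirDeriv f (δ s) (Complex.I * v s) ^ 2 *
        (r * dirDeriv₂ f (δ s) (v s) (v s) + dirDeriv f (δ s) (Complex.I * v s)) by ring] at e
      rw [e] at e1
      simp only [map_sub, map_mul, map_pow, eval_C, e2, ← e1]
      ring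
  obtain ⟨W, hW⟩ := hdiv
  have := congrArg (eval p) hW
  simp only [map_sub, map_mul, map_pow, eval_C, hX, hY, hp] at this
  exact hK0 (by simpa using this)

end IsTangentCircleFrame
-- The reflection law on the complex curve
theorem exists_eval_shift_eq_add_mul_sqrt (F Q : MvPolynomial (Fin 2) ℂ)
    (U : Fin 2 → MvPolynomial (Fin 2) ℂ) :
    ∃ (N : ℕ) (X Y : MvPolynomial (Fin 2) ℂ), ∀ p ρ, ρ ≠ 0 → ρ ^ 2 = eval p Q →
      eval p Q ^ N * eval (fun i => p i + eval p (U i) / ρ) F = eval p X + eval p Y * ρ := by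
  induction F using MvPolynomial.induction_on with
  | C a => exact ⟨0, C a, 0, fun p ρ _ _ => by simp⟩
  | add F G hF hG =>
    obtain ⟨N, X, Y, h⟩ := hF
    obtain ⟨N', X', Y', h'⟩ := hG
    refine ⟨N + N', Q ^ N' * X + Q ^ N * X', Q ^ N' * Y + Q ^ N * Y', fun p ρ h0 hρ => ?_⟩
    have e := h p ρ h0 hρ
    have e' := h' p ρ h0 hρ
    simp only [map_add, map_mul, map_pow]
    linear_combination (eval p Q ^ N') * e + (eval p Q ^ N) * e'
  | mul_X F i hF =>
    obtain ⟨N, X, Y, h⟩ := hF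
    refine ⟨N + 1, X * Q * MvPolynomial.X i + Y * Q * U i,
      X * U i + Y * Q * MvPolynomial.X i, fun p ρ h0 hρ => ?_⟩
    have e := h p ρ h0 hρ
    have e1 : eval p Q * (p i + eval p (U i) / ρ) = eval p Q * p i + eval p (U i) * ρ := by
      rw [← hρ]
      field_simp
    simp only [map_add, map_mul, eval_X]
    linear_combination (eval p Q * (p i + eval p (U i) / ρ)) * e
      + (eval p X + eval p Y * ρ) * e1 + eval p Y * eval p (U i) * hρ


theorem circlePoint_eq (δ v : ℝ → ℂ) (r s ε : ℝ) : circlePoint δ v r s ε =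
    δ s + (r * (1 - Real.cos ε) : ℝ) * (Complex.I * v s) + (r * Real.sin ε : ℝ) * v s := by
  rw [circlePoint, Complex.exp_mul_I]
  push_cast
  linear_combination (-(Complex.sin ε * r * v s)) * Complex.I_mul_I

/-- The displacement, multiplied by `|∇f|`, with components `a` along the normal and `b` along the
tangent of the level curve of `f`. -/
noncomputable def frameShift (f : MvPolynomial (Fin 2) ℂ) (a b : ℂ) :
    Fin 2 → MvPolynomial (Fin 2) ℂ :=
  ![C a * pderiv 0 f + C b * pderiv 1 f, C a * pderiv 1 f - C b * pderiv 0 f]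

namespace IsTangentCircleFrame

variable {δ v : ℝ → ℂ} {lam kap : ℝ → ℝ} {r L : ℝ}

/-- The invariance under reflection extends to the complex curve `{f = 0}`. -/
theorem eval_reflection (h : IsTangentCircleFrame δ v lam kap r L)
    {f F : MvPolynomial (Fin 2) ℂ} (hf : Irreducible f) (hfδ : ∀ s, realPointEval f (δ s) = 0)
    (hF : IsReflectionInvariant δ v r F) {ε : ℝ} (h0 : 0 < ε) (hπ : ε < Real.pi)
    {p : Fin 2 → ℂ} (hp : eval p f = 0) {w : ℂ} (hw0 : w ≠ 0) (hw : w ^ 2 = eval p (gradSq f)) :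
    ∃ σ : ℂ, (σ = 1 ∨ σ = -1) ∧
      eval (fun i => p i + eval p (frameShift f (r * (1 - Real.cos ε) : ℝ)
        (r * Real.sin ε : ℝ) i) / (σ * w)) F =
      eval (fun i => p i + eval p (frameShift f (r * (1 - Real.cos ε) : ℝ)
        (-(r * Real.sin ε : ℝ)) i) / (σ * w)) F := by
  set a : ℝ := r * (1 - Real.cos ε) with ha
  set b : ℝ := r * Real.sin ε with hb
  obtain ⟨N, X, Y, h1⟩ := exists_eval_shift_eq_add_mul_sqrt F (gradSq f) (frameShift f a b)
  obtain ⟨N', X', Y', h2⟩ := exists_eval_shift_eq_add_mul_sqrt F (gradSq f) (frameShift f a (-b))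
  set A := gradSq f ^ N' * X - gradSq f ^ N * X' with hA
  set B := gradSq f ^ N' * Y - gradSq f ^ N * Y' with hB
  have key : ∀ p ρ, ρ ≠ 0 → ρ ^ 2 = eval p (gradSq f) →
      eval p (gradSq f) ^ (N + N') * (eval (fun i => p i + eval p (frameShift f a b i) / ρ) F -
        eval (fun i => p i + eval p (frameShift f a (-b) i) / ρ) F) = eval p A + eval p B * ρ := by
    intro p ρ hρ0 hρ
    have e1 := h1 p ρ hρ0 hρ
    have e2 := h2 p ρ hρ0 hρ
    simp only [hA, hB, map_sub, map_mul, map_pow]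
    linear_combination (eval p (gradSq f) ^ N') * e1 - (eval p (gradSq f) ^ N) * e2
  have hdiv : f ∣ gradSq f * (A ^ 2 - B ^ 2 * gradSq f) :=
    -- On δ invariance gives A + Bρ = 0 wherever ρ ≠ 0, hence A^2 - B^2 ρ^2 = 0. The extra factor
    -- |∇f|^2 covers the points with ρ = 0.
    h.curve.dvd_of_vanish hf hfδ fun s => by
      set ρ := dirDeriv f (δ s) (Complex.I * v s) with hρ
      have e3 := h.gradSq_eq hfδ s
      have ex := h.pderiv_zero_eq hfδ s
      have ey := h.pderiv_one_eq hfδ s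
      rw [← hρ] at e3 ex ey
      rw [realPointEval, map_mul]
      rw [realPointEval] at e3 ex ey
      by_cases hρ0 : ρ = 0
      · rw [e3, hρ0]; simp
      · have e4 := key _ ρ hρ0 e3.symm
        have e5 := hF s ε h0 hπ
        have hc1 : realPointEval F (circlePoint δ v r s ε) = eval (fun i =>
            ![((δ s).re : ℂ), ((δ s).im : ℂ)] i +
            eval ![((δ s).re : ℂ), ((δ s).im : ℂ)] (frameShift f a b i) / ρ) F := by
          rw [realPointEval, circlePoint_eq, ← ha, ← hb]
          congr 2
          funext i
          fin_cases i
          · simp [frameShift, ex, ey]; field_simp; ring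
          · simp [frameShift, ex, ey]; field_simp; ring
        have hc2 : realPointEval F (circlePoint δ v r s (-ε)) = eval (fun i =>
            ![((δ s).re : ℂ), ((δ s).im : ℂ)] i +
            eval ![((δ s).re : ℂ), ((δ s).im : ℂ)] (frameShift f a (-b) i) / ρ) F := by
          rw [realPointEval, circlePoint_eq, Real.cos_neg, Real.sin_neg, mul_neg, ← ha, ← hb]
          congr 2
          funext i
          fin_cases i
          · simp [frameShift, ex, ey]; field_simp; ring
          · simp [frameShift, ex, ey]; field_simp; ring
        rw [hc1, hc2] at e5
        rw [e5, sub_self, mul_zero] at e4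
        simp only [map_sub, map_mul, map_pow]
        rw [e3]
        linear_combination (-(ρ ^ 2 * (eval ![((δ s).re : ℂ), ((δ s).im : ℂ)] A -
          eval ![((δ s).re : ℂ), ((δ s).im : ℂ)] B * ρ))) * e4
  obtain ⟨W, hW⟩ := hdiv
  have e := congrArg (eval p) hW
  simp only [map_sub, map_mul, map_pow, hp, zero_mul, ← hw] at e
  -- At a complex point there is no preferred square root of |∇f|^2: the law holds for w or for -w,
  -- and σ records which.
  have hfac : (eval p A + eval p B * w) * (eval p A + eval p B * (-w)) = 0 := by
    have e' : w ^ 2 * ((eval p A + eval p B * w) * (eval p A + eval p B * (-w))) = 0 := by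
      linear_combination e
    exact (mul_eq_zero.1 e').resolve_left (pow_ne_zero 2 hw0)
  have hQ : eval p (gradSq f) ^ (N + N') ≠ 0 := by
    rw [← hw]; exact pow_ne_zero _ (pow_ne_zero _ hw0)
  rcases mul_eq_zero.1 hfac with h3 | h3
  · refine ⟨1, Or.inl rfl, ?_⟩
    rw [← key p w hw0 hw] at h3
    rw [one_mul]
    exact sub_eq_zero.1 ((mul_eq_zero.1 h3).resolve_left hQ)
  · refine ⟨-1, Or.inr rfl, ?_⟩
    rw [← key p (-w) (neg_ne_zero.2 hw0) (by rw [neg_sq, hw])] at h3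
    rw [neg_one_mul]
    exact sub_eq_zero.1 ((mul_eq_zero.1 h3).resolve_left hQ)

end IsTangentCircleFrame

/-! ### Homogenization, asymptotics and branches at infinity -/

theorem eval_homogenization (f : MvPolynomial (Fin 2) ℂ) (x y : ℂ) {z : ℂ} (hz : z ≠ 0) :
    eval ![x, y, z] (homogenization f) = z ^ f.totalDegree * eval ![x / z, y / z] f := by
  rw [homogenization, map_sum, eval_eq', Finset.mul_sum]
  refine Finset.sum_congr rfl fun d hd => ?_
  have h1 : d 0 + d 1 ≤ f.totalDegree := by
    have := le_totalDegree hd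
    rwa [Finsupp.sum_fintype _ _ (by simp), Fin.sum_univ_two] at this
  simp only [map_mul, eval_C, map_pow, eval_X, Fin.prod_univ_two, Matrix.cons_val_zero,
    Matrix.cons_val_one, Matrix.cons_val, div_pow]
  rw [← Nat.sub_add_cancel h1]
  simp only [Nat.add_sub_cancel, pow_add]
  field_simp

theorem isHomogeneous_homogenization (f : MvPolynomial (Fin 2) ℂ) :
    (homogenization f).IsHomogeneous f.totalDegree := by
  refine IsHomogeneous.sum _ _ _ fun d hd => ?_
  have h1 : d 0 + d 1 ≤ f.totalDegree := by
    have := le_totalDegree hd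
    rwa [Finsupp.sum_fintype _ _ (by simp), Fin.sum_univ_two] at this
  have h2 := (isHomogeneous_C (Fin 3) (coeff d f)).mul
    ((((isHomogeneous_X ℂ (0 : Fin 3)).pow (d 0)).mul
      ((isHomogeneous_X ℂ (1 : Fin 3)).pow (d 1))).mul
      ((isHomogeneous_X ℂ (2 : Fin 3)).pow (f.totalDegree - (d 0 + d 1))))
  convert! h2 using 1
  omega

theorem euler_homogenization (f : MvPolynomial (Fin 2) ℂ) (Z : Fin 3 → ℂ) :
    Z 0 * eval Z (pderiv 0 (homogenization f)) + Z 1 * eval Z (pderiv 1 (homogenization f)) +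
      Z 2 * eval Z (pderiv 2 (homogenization f)) =
      f.totalDegree * eval Z (homogenization f) := by
  have := congrArg (eval Z) (isHomogeneous_homogenization f).sum_X_mul_pderiv
  simpa [Fin.sum_univ_three] using this

theorem eval_pderiv_homogenization_zero (f : MvPolynomial (Fin 2) ℂ) (x y : ℂ) {z : ℂ}
    (hz : z ≠ 0) : eval ![x, y, z] (pderiv 0 (homogenization f)) =
      z ^ f.totalDegree / z * eval ![x / z, y / z] (pderiv 0 f) := by
  have h1 := hasDerivAt_eval_mvPolynomial (𝕜 := ℂ) (x := fun t => ![t, y, z]) (x' := ![1, 0, 0])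
    (t := x) (by
      intro i
      fin_cases i
      exacts [hasDerivAt_id x, hasDerivAt_const x y, hasDerivAt_const x z]) (homogenization f)
  have h2 := (hasDerivAt_eval_mvPolynomial (𝕜 := ℂ) (x := fun t => ![t / z, y / z])
    (x' := ![1 / z, 0]) (t := x) (by
      intro i
      fin_cases i
      exacts [(hasDerivAt_id x).div_const z, hasDerivAt_const x (y / z)]) f).const_mul
        (z ^ f.totalDegree)
  simp only [eval_homogenization f _ y hz] at h1
  have h3 := h1.unique h2
  simp [Fin.sum_univ_three] at h3
  rw [h3]
  field_simp

theorem eval_pderiv_homogenization_one (f : MvPolynomial (Fin 2) ℂ) (x y : ℂ) {z : ℂ}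
    (hz : z ≠ 0) : eval ![x, y, z] (pderiv 1 (homogenization f)) =
      z ^ f.totalDegree / z * eval ![x / z, y / z] (pderiv 1 f) := by
  have h1 := hasDerivAt_eval_mvPolynomial (𝕜 := ℂ) (x := fun t => ![x, t, z]) (x' := ![0, 1, 0])
    (t := y) (by
      intro i
      fin_cases i
      exacts [hasDerivAt_const y x, hasDerivAt_id y, hasDerivAt_const y z]) (homogenization f)
  have h2 := (hasDerivAt_eval_mvPolynomial (𝕜 := ℂ) (x := fun t => ![x / z, t / z])
    (x' := ![0, 1 / z]) (t := y) (by
      intro i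
      fin_cases i
      exacts [hasDerivAt_const y (x / z), (hasDerivAt_id y).div_const z]) f).const_mul
        (z ^ f.totalDegree)
  simp only [eval_homogenization f x _ hz] at h1
  have h3 := h1.unique h2
  simp [Fin.sum_univ_three] at h3
  rw [h3]
  field_simp

/-- The pair `φ, ψ` converges to `a`, and its difference quotient with respect to `t` converges
to `a'`, as `t → 0`. -/
def HasPairLimit (φ ψ : ℂ → ℂ) (a a' : ℂ) : Prop :=
  Tendsto φ (𝓝[≠] 0) (𝓝 a) ∧ Tendsto ψ (𝓝[≠] 0) (𝓝 a) ∧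
    Tendsto (fun t => (φ t - ψ t) / t) (𝓝[≠] 0) (𝓝 a')

namespace HasPairLimit

variable {φ ψ φ₁ ψ₁ : ℂ → ℂ} {a a' b b' : ℂ}

theorem diag (h : Tendsto φ (𝓝[≠] 0) (𝓝 a)) : HasPairLimit φ φ a 0 :=
  ⟨h, h, by simp⟩

theorem const (c : ℂ) : HasPairLimit (fun _ => c) (fun _ => c) c 0 :=
  diag tendsto_const_nhds

theorem add (h : HasPairLimit φ ψ a a') (h₁ : HasPairLimit φ₁ ψ₁ b b') :
    HasPairLimit (fun t => φ t + φ₁ t) (fun t => ψ t + ψ₁ t) (a + b) (a' + b') :=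
  ⟨h.1.add h₁.1, h.2.1.add h₁.2.1, (h.2.2.add h₁.2.2).congr fun t => by ring⟩

theorem mul (h : HasPairLimit φ ψ a a') (h₁ : HasPairLimit φ₁ ψ₁ b b') :
    HasPairLimit (fun t => φ t * φ₁ t) (fun t => ψ t * ψ₁ t) (a * b) (a' * b + a * b') :=
  ⟨h.1.mul h₁.1, h.2.1.mul h₁.2.1, ((h.2.2.mul h₁.1).add (h.2.1.mul h₁.2.2)).congr fun t => by
    ring⟩

theorem pow (h : HasPairLimit φ ψ a a') (n : ℕ) :
    HasPairLimit (fun t => φ t ^ n) (fun t => ψ t ^ n) (a ^ n) (n * a ^ (n - 1) * a') := by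
  induction n with
  | zero => simpa using const 1
  | succ n ih =>
    have := ih.mul h
    simp only [pow_succ]
    convert! this using 1
    rcases n with _ | n
    · simp
    · simp only [Nat.add_sub_cancel, pow_succ]
      push_cast
      ring

theorem polynomial_eval (h : HasPairLimit φ ψ a a') (R : Polynomial ℂ) :
    HasPairLimit (fun t => R.eval (φ t)) (fun t => R.eval (ψ t)) (R.eval a)
      (R.derivative.eval a * a') := by
  induction R using Polynomial.induction_on' with
  | add p q hp hq =>
    have := hp.add hq
    simp only [Polynomial.eval_add, Polynomial.derivative_add, add_mul]
    exact this
  | monomial n c =>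
    have := (const c).mul (h.pow n)
    simp only [Polynomial.eval_monomial, Polynomial.derivative_monomial]
    convert! this using 1
    ring

theorem sum {ι : Type*} (s : Finset ι) {φ ψ : ι → ℂ → ℂ} {a a' : ι → ℂ}
    (h : ∀ i ∈ s, HasPairLimit (φ i) (ψ i) (a i) (a' i)) :
    HasPairLimit (fun t => ∑ i ∈ s, φ i t) (fun t => ∑ i ∈ s, ψ i t) (∑ i ∈ s, a i)
      (∑ i ∈ s, a' i) := by
  refine ⟨tendsto_finsetSum s fun i hi => (h i hi).1, tendsto_finsetSum s fun i hi => (h i hi).2.1,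
    (tendsto_finsetSum s fun i hi => (h i hi).2.2).congr fun t => ?_⟩
  rw [← Finset.sum_div, Finset.sum_sub_distrib]

end HasPairLimit

/-- Two nearby points receding to infinity in the `X`-direction, at different `X`-coordinates, are
separated by every polynomial that depends on `X`. -/
theorem eventually_eval_ne {P : Polynomial (Polynomial ℂ)} (hN : P.natDegree ≠ 0)
    {D E y z : ℂ → ℂ} {d e η : ℂ} (hD : Tendsto D (𝓝[≠] 0) (𝓝 d))
    (hE : Tendsto E (𝓝[≠] 0) (𝓝 e)) (hde : d ≠ e) (hyz : HasPairLimit y z η 0)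
    (hη : P.leadingCoeff.eval η ≠ 0) :
    ∀ᶠ t in 𝓝[≠] 0, (P.eval (Polynomial.C (1 / t + D t))).eval (y t) ≠
      (P.eval (Polynomial.C (1 / t + E t))).eval (z t) := by
  set N := P.natDegree with hNdef
  have ht : Tendsto (fun t : ℂ => t) (𝓝[≠] 0) (𝓝 0) := tendsto_id.mono_left nhdsWithin_le_nhds
  have hx : HasPairLimit (fun t => 1 + t * D t) (fun t => 1 + t * E t) 1 (d - e) := by
    refine ⟨by simpa using (ht.mul hD).const_add 1, by simpa using (ht.mul hE).const_add 1,
      (hD.sub hE).congr' ?_⟩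
    filter_upwards [self_mem_nhdsWithin] with t ht
    have : t ≠ 0 := ht
    field_simp
    ring
  -- After multiplication by t^N the value of P is the sum of coeff_j(y) (1 + tD)^j t^(N-j). In the
  -- difference quotient the terms with j < N tend to 0, and the top one tends to the leading
  -- coefficient at η times N (d - e).
  have hsum := HasPairLimit.sum (Finset.range (N + 1)) fun j _ =>
    ((hyz.polynomial_eval (P.coeff j)).mul (hx.pow j)).mul (HasPairLimit.diag (ht.pow (N - j)))
  have hlim := hsum.2.2
  have hval : ∑ j ∈ Finset.range (N + 1), (((P.coeff j).derivative.eval η * 0 * 1 ^ j +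
      (P.coeff j).eval η * (j * 1 ^ (j - 1) * (d - e))) * 0 ^ (N - j) +
      (P.coeff j).eval η * 1 ^ j * 0) = P.leadingCoeff.eval η * (N * (d - e)) := by
    rw [Finset.sum_eq_single N]
    · rw [Polynomial.leadingCoeff, ← hNdef]
      simp
    · intro j hj hjN
      have : N - j ≠ 0 := by
        have := Finset.mem_range.1 hj
        omega
      simp [this]
    · simp
  rw [hval] at hlim
  have hne : P.leadingCoeff.eval η * (N * (d - e)) ≠ 0 :=
    mul_ne_zero hη (mul_ne_zero (by exact_mod_cast hN) (sub_ne_zero.2 hde))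
  have key : ∀ t : ℂ, t ≠ 0 → ∀ D y : ℂ, ∑ j ∈ Finset.range (N + 1),
      (P.coeff j).eval y * (1 + t * D) ^ j * t ^ (N - j) =
      t ^ N * (P.eval (Polynomial.C (1 / t + D))).eval y := by
    intro t ht D y
    rw [Polynomial.eval_eq_sum_range (p := P), Polynomial.eval_finsetSum, Finset.mul_sum]
    refine Finset.sum_congr rfl fun j hj => ?_
    have hj' : j ≤ N := Nat.lt_succ_iff.1 (Finset.mem_range.1 hj)
    have h1 : 1 + t * D = t * (1 / t + D) := by field_simp
    rw [Polynomial.eval_mul, Polynomial.eval_pow, Polynomial.eval_C, h1, mul_pow]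
    conv_rhs => rw [← Nat.sub_add_cancel hj', pow_add]
    ring
  filter_upwards [hlim.eventually_ne hne, self_mem_nhdsWithin] with t h1 h2 h3
  apply h1
  rw [key t h2, key t h2, h3, sub_self, zero_div]

/-- The polynomial `F` in the coordinates `X`, `Y` with `(x, y) = X • (a, b) + Y • (-b, a)`. -/
noncomputable def rotatedPolynomial (F : MvPolynomial (Fin 2) ℂ) (a b : ℂ) :
    Polynomial (Polynomial ℂ) :=
  aeval ![Polynomial.C (Polynomial.C a) * Polynomial.X -
      Polynomial.C (Polynomial.C b * Polynomial.X),
    Polynomial.C (Polynomial.C b) * Polynomial.X + Polynomial.C (Polynomial.C a * Polynomial.X)] F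

theorem eval_rotatedPolynomial (F : MvPolynomial (Fin 2) ℂ) (a b X Y : ℂ) :
    ((rotatedPolynomial F a b).eval (Polynomial.C X)).eval Y =
      eval ![a * X - b * Y, b * X + a * Y] F := by
  induction F using MvPolynomial.induction_on with
  | C c => simp [rotatedPolynomial]
  | add p q hp hq =>
    simp only [rotatedPolynomial, map_add, Polynomial.eval_add] at hp hq ⊢
    rw [hp, hq]
  | mul_X p i hp =>
    simp only [rotatedPolynomial, map_mul, Polynomial.eval_mul, aeval_X, eval_X] at hp ⊢
    rw [hp]
    fin_cases i <;> simp

/-- The quantity in `hα` is the derivative of h in the direction (-b, a, 0). When it is nonzero, the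
implicit function theorem parametrises the zero set near (a : b : 0) by t = z, with y₀ the
derivative of the transverse coordinate. -/
theorem exists_implicit_root {h : MvPolynomial (Fin 3) ℂ} {a b : ℂ} (h0 : eval ![a, b, 0] h = 0)
    (hα : a * eval ![a, b, 0] (pderiv 1 h) - b * eval ![a, b, 0] (pderiv 0 h) ≠ 0) :
    ∃ u : ℂ → ℂ, ∃ y₀ : ℂ, u 0 = 0 ∧ HasDerivAt u y₀ 0 ∧
      (∀ᶠ t in 𝓝 0, eval ![a - b * u t, b + a * u t, t] h = 0) ∧
      y₀ * (a * eval ![a, b, 0] (pderiv 1 h) - b * eval ![a, b, 0] (pderiv 0 h)) +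
        eval ![a, b, 0] (pderiv 2 h) = 0 := by
  set k : ℂ × ℂ → ℂ := fun x => eval ![a - b * x.2, b + a * x.2, x.1] h with hk
  have hkd : ContDiff ℂ 1 k := by
    have : ∀ P : MvPolynomial (Fin 3) ℂ,
        ContDiff ℂ 1 fun x : ℂ × ℂ => eval ![a - b * x.2, b + a * x.2, x.1] P := by
      intro P
      induction P using MvPolynomial.induction_on with
      | C c => simpa using contDiff_const
      | add p q hp hq => simpa using hp.add hq
      | mul_X p i hp =>
        simp only [map_mul, eval_X]
        refine hp.mul ?_
        fin_cases i
        · exact contDiff_const.sub (contDiff_const.mul contDiff_snd)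
        · exact contDiff_const.add (contDiff_const.mul contDiff_snd)
        · exact contDiff_fst
    exact this h
  have hs := (hkd.contDiffAt (x := (0, 0))).hasStrictFDerivAt (by simp)
  set α := a * eval ![a, b, 0] (pderiv 1 h) - b * eval ![a, b, 0] (pderiv 0 h) with hαdef
  have hline : ∀ y t : ℂ, HasDerivAt (fun τ : ℂ => k (t * τ, y * τ))
      (y * α + t * eval ![a, b, 0] (pderiv 2 h)) 0 := by
    intro y t
    have h1 := hasDerivAt_eval_mvPolynomial (𝕜 := ℂ) (t := 0)
      (x := fun τ : ℂ => ![a - b * (y * τ), b + a * (y * τ), t * τ])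
      (x' := ![-(b * y), a * y, t]) (by
        intro i
        have hid := hasDerivAt_id (0 : ℂ)
        fin_cases i
        · simpa using ((hid.const_mul y).const_mul b).const_sub a
        · simpa using ((hid.const_mul y).const_mul a).const_add b
        · simpa using hid.const_mul t) h
    convert! h1 using 1
    simp [Fin.sum_univ_three, hαdef]
    ring
  have hfd : ∀ t y : ℂ, fderiv ℂ k (0, 0) (t, y) = y * α + t * eval ![a, b, 0] (pderiv 2 h) := by
    intro t y
    have hl : HasDerivAt (fun τ : ℂ => (t * τ, y * τ)) (t, y) 0 := by
      have hid := hasDerivAt_id (0 : ℂ)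
      simpa using (hid.const_mul t).prodMk (hid.const_mul y)
    have h2 : HasFDerivAt k (fderiv ℂ k (0, 0)) ((fun τ : ℂ => (t * τ, y * τ)) 0) := by
      simpa using hs.hasFDerivAt
    have h3 := h2.comp_hasDerivAt (0 : ℂ) hl
    have h4 : HasDerivAt (k ∘ fun τ : ℂ => (t * τ, y * τ))
        (y * α + t * eval ![a, b, 0] (pderiv 2 h)) 0 := hline y t
    exact h3.unique h4
  have hinv : (fderiv ℂ k (0, 0) ∘L .inr ℂ ℂ ℂ).IsInvertible := by
    refine ⟨ContinuousLinearEquiv.unitsEquivAut ℂ (Units.mk0 α hα), ?_⟩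
    ext
    simp [hfd]
  set u := hs.implicitFunctionOfProdDomain hinv
  have hk0 : k (0, 0) = 0 := by simp [hk, h0]
  have hu0 : u 0 = 0 :=
    (hs.eventually_apply_eq_iff_implicitFunctionOfProdDomain hinv).self_of_nhds.1 rfl
  have hroot := hs.eventually_apply_implicitFunctionOfProdDomain hinv
  have hud := (hs.hasStrictFDerivAt_implicitFunctionOfProdDomain hinv).hasFDerivAt.hasDerivAt
  refine ⟨u, _, hu0, hud, ?_, ?_⟩
  · filter_upwards [hroot] with t ht
    rw [hk0] at ht
    exact ht
  · have h1 : HasDerivAt (fun t => (t, u t)) _ (0 : ℂ) := (hasDerivAt_id (0 : ℂ)).prodMk hud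
    have h2 : HasFDerivAt k (fderiv ℂ k (0, 0)) ((fun t => (t, u t)) 0) := by
      simpa [hu0] using hs.hasFDerivAt
    have h3 := h2.comp_hasDerivAt (0 : ℂ) h1
    have h4 : (k ∘ fun t => (t, u t)) =ᶠ[𝓝 0] fun _ => (0 : ℂ) := by
      filter_upwards [hroot] with t ht
      rw [hk0] at ht
      exact ht
    have h5 := h3.unique ((hasDerivAt_const (0 : ℂ) (0 : ℂ)).congr_of_eventuallyEq h4)
    rw [hfd, one_mul] at h5
    exact h5

theorem exists_sqrt_one_add_sq {μ : ℂ → ℂ} (hμ : Tendsto μ (𝓝[≠] 0) (𝓝 0)) :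
    ∃ κ : ℂ → ℂ, (∀ t, κ t ^ 2 = 1 + μ t ^ 2) ∧ Tendsto κ (𝓝[≠] 0) (𝓝 1) := by
  refine ⟨fun t => (1 + μ t ^ 2) ^ ((2 : ℕ) : ℂ)⁻¹, fun t => Complex.cpow_nat_inv_pow _ two_ne_zero,
    ?_⟩
  have h1 : Tendsto (fun t => 1 + μ t ^ 2) (𝓝[≠] 0) (𝓝 1) := by
    simpa using (hμ.pow 2).const_add 1
  have h2 : ContinuousAt (fun z : ℂ => z ^ ((2 : ℕ) : ℂ)⁻¹) 1 :=
    continuousAt_cpow_const Complex.one_mem_slitPlane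
  have h3 := h2.tendsto.comp h1
  rwa [Complex.one_cpow] at h3

/-- A point of the curve near a transversal point at infinity, its asymptotics and the asymptotics
of the gradient. -/
theorem exists_branch_at_infinity {f : MvPolynomial (Fin 2) ℂ} {a b : ℂ} (hq : a ^ 2 + b ^ 2 ≠ 0)
    (h0 : eval ![a, b, 0] (homogenization f) = 0)
    (hα : a * eval ![a, b, 0] (pderiv 1 (homogenization f)) -
      b * eval ![a, b, 0] (pderiv 0 (homogenization f)) ≠ 0) :
    ∃ (y₀ : ℂ) (Y μ B : ℂ → ℂ), Tendsto Y (𝓝[≠] 0) (𝓝 y₀) ∧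
      Tendsto (fun t => μ t / t) (𝓝[≠] 0) (𝓝 0) ∧
      ∀ᶠ t in 𝓝[≠] 0, eval ![a / t - b * Y t, b / t + a * Y t] f = 0 ∧ B t ≠ 0 ∧
        eval ![a / t - b * Y t, b / t + a * Y t] (pderiv 0 f) = B t * (μ t * a - b) ∧
        eval ![a / t - b * Y t, b / t + a * Y t] (pderiv 1 f) = B t * (μ t * b + a) := by
  obtain ⟨u, y₀, hu0, hu, hroot, hy₀⟩ := exists_implicit_root h0 hα
  set q := a ^ 2 + b ^ 2 with hqdef
  set ζ : ℂ → Fin 3 → ℂ := fun t => ![a - b * u t, b + a * u t, t] with hζ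
  set α := a * eval ![a, b, 0] (pderiv 1 (homogenization f)) -
      b * eval ![a, b, 0] (pderiv 0 (homogenization f)) with hαdef
  have hYlim : Tendsto (fun t => u t / t) (𝓝[≠] 0) (𝓝 y₀) := by
    refine hu.tendsto_slope.congr fun t => ?_
    rw [slope_def_field, hu0, sub_zero, sub_zero]
  have hζc : ContinuousAt ζ 0 := by
    refine continuousAt_pi.2 fun i => ?_
    have hc := hu.continuousAt
    fin_cases i
    · exact continuousAt_const.sub (continuousAt_const.mul hc)
    · exact continuousAt_const.add (continuousAt_const.mul hc)
    · exact continuousAt_id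
  have hζ0 : ζ 0 = ![a, b, 0] := by simp [hζ, hu0]
  have hlim : ∀ P : MvPolynomial (Fin 3) ℂ,
      Tendsto (fun t => eval (ζ t) P) (𝓝[≠] 0) (𝓝 (eval ![a, b, 0] P)) := by
    intro P
    have h1 : Tendsto (fun t => eval (ζ t) P) (𝓝 0) (𝓝 (eval (ζ 0) P)) :=
      (MvPolynomial.continuous_eval P).continuousAt.comp hζc
    rw [hζ0] at h1
    exact h1.mono_left nhdsWithin_le_nhds
  have l0 := hlim (pderiv 0 (homogenization f))
  have l1 := hlim (pderiv 1 (homogenization f))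
  have l2 := hlim (pderiv 2 (homogenization f))
  set h₀ := fun t => eval (ζ t) (pderiv 0 (homogenization f))
  set h₁ := fun t => eval (ζ t) (pderiv 1 (homogenization f))
  set h₂ := fun t => eval (ζ t) (pderiv 2 (homogenization f))
  have lB : Tendsto (fun t => a * h₁ t - b * h₀ t) (𝓝[≠] 0) (𝓝 α) :=
    (l1.const_mul a).sub (l0.const_mul b)
  have hroot' : ∀ᶠ t in 𝓝[≠] (0 : ℂ), eval (ζ t) (homogenization f) = 0 :=
    hroot.filter_mono nhdsWithin_le_nhds
  -- By Euler's relation on the curve this quotient equals -((u/t)(a h₁ - b h₀) + h₂), whose limit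
  -- is -(y₀ α + h₂(0)) = 0. This is what makes μ = o(t), rather than merely o(1).
  have lA : Tendsto (fun t => (a * h₀ t + b * h₁ t) / t) (𝓝[≠] 0) (𝓝 0) := by
    have h1 := ((hYlim.mul lB).add l2).neg
    rw [hy₀, neg_zero] at h1
    refine h1.congr' ?_
    filter_upwards [hroot', self_mem_nhdsWithin] with t ht ht0
    have ht0' : t ≠ 0 := ht0
    have he := euler_homogenization f (ζ t)
    rw [ht, mul_zero] at he
    have he' : (a - b * u t) * h₀ t + (b + a * u t) * h₁ t + t * h₂ t = 0 := he
    field_simp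
    linear_combination -he'
  -- μ is the ratio of the gradient's components along (a, b) and (-b, a). The factor t / t^deg
  -- converts derivatives of the homogenization into derivatives of f.
  refine ⟨y₀, fun t => u t / t, fun t => (a * h₀ t + b * h₁ t) / (a * h₁ t - b * h₀ t),
    fun t => (a * h₁ t - b * h₀ t) / q * (t / t ^ f.totalDegree), hYlim, ?_, ?_⟩
  · have h1 := lA.div lB hα
    rw [zero_div] at h1
    exact h1.congr fun t => by simp only [Pi.div_apply]; rw [div_right_comm]
  · filter_upwards [hroot', self_mem_nhdsWithin, lB.eventually_ne hα] with t ht ht0 hB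
    have ht0' : t ≠ 0 := ht0
    have hpow : t ^ f.totalDegree ≠ 0 := pow_ne_zero _ ht0'
    have hpt : ![a / t - b * (u t / t), b / t + a * (u t / t)] =
        ![(a - b * u t) / t, (b + a * u t) / t] := by
      funext i
      fin_cases i
      · simp only [Fin.zero_eta, Matrix.cons_val_zero]; ring
      · simp only [Fin.mk_one, Matrix.cons_val_one, Matrix.cons_val_fin_one]; ring
    have e := eval_homogenization f (a - b * u t) (b + a * u t) ht0'
    have e0 : h₀ t = _ := eval_pderiv_homogenization_zero f (a - b * u t) (b + a * u t) ht0'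
    have e1 : h₁ t = _ := eval_pderiv_homogenization_one f (a - b * u t) (b + a * u t) ht0'
    have ht' : eval ![a - b * u t, b + a * u t, t] (homogenization f) = 0 := ht
    rw [ht'] at e
    rw [hpt]
    refine ⟨(mul_eq_zero.1 e.symm).resolve_left hpow, ?_, ?_, ?_⟩
    · exact mul_ne_zero (div_ne_zero hB hq) (div_ne_zero ht0' hpow)
    · have : eval ![(a - b * u t) / t, (b + a * u t) / t] (pderiv 0 f) =
          h₀ t * (t / t ^ f.totalDegree) := by
        rw [e0]; field_simp
      rw [this]
      set B' := a * h₁ t - b * h₀ t with hB'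
      field_simp
      rw [hqdef, hB']
      ring
    · have : eval ![(a - b * u t) / t, (b + a * u t) / t] (pderiv 1 f) =
          h₁ t * (t / t ^ f.totalDegree) := by rw [e1]; field_simp
      rw [this]
      set B' := a * h₁ t - b * h₀ t with hB'
      field_simp
      rw [hqdef, hB']
      ring

/-- A generic angle for which given nonzero polynomial conditions on the height hold. -/
theorem exists_angle {r : ℝ} (hr : 0 < r) {R : Polynomial ℂ} (hR : R ≠ 0) :
    ∃ ε : ℝ, 0 < ε ∧ ε < Real.pi ∧ R.eval ((r * (1 - Real.cos ε) : ℝ) : ℂ) ≠ 0 := by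
  by_contra! h
  apply hR
  apply Polynomial.eq_zero_of_infinite_isRoot
  have hinj : Set.InjOn (fun ε : ℝ => ((r * (1 - Real.cos ε) : ℝ) : ℂ)) (Set.Ioo 0 Real.pi) := by
    intro x hx y hy hxy
    have h1 : r * (1 - Real.cos x) = r * (1 - Real.cos y) := Complex.ofReal_injective hxy
    have h2 := mul_left_cancel₀ hr.ne' h1
    exact Real.injOn_cos ⟨hx.1.le, hx.2.le⟩ ⟨hy.1.le, hy.2.le⟩ (by linarith)
  refine ((Set.Ioo_infinite Real.pi_pos).image hinj).mono ?_
  rintro _ ⟨ε, hε, rfl⟩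
  exact h ε hε.1 hε.2

theorem comp_affine_ne_zero {R : Polynomial ℂ} (hR : R ≠ 0) (y : ℂ) {θ : ℂ} (hθ : θ ≠ 0) :
    R.comp (Polynomial.C y + Polynomial.C θ * Polynomial.X) ≠ 0 := by
  intro h
  rcases Polynomial.comp_eq_zero_iff.1 h with h | ⟨-, h⟩
  · exact hR h
  · have := congrArg (fun p => Polynomial.coeff p 1) h
    simp at this
    exact hθ this

/-! ### Absence of transversal points at infinity -/

namespace IsTangentCircleFrame

variable {δ v : ℝ → ℂ} {lam kap : ℝ → ℝ} {r L : ℝ}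

/-- Otherwise F is a polynomial in one complex linear coordinate. It is constant on δ, while that
coordinate is nonconstant there because δ lies on no line; so F would be constant. -/
theorem natDegree_rotatedPolynomial_ne_zero (h : IsTangentCircleFrame δ v lam kap r L)
    {F : MvPolynomial (Fin 2) ℂ} (hFc : ∀ c, F ≠ C c) (hF : IsReflectionInvariant δ v r F)
    {a b : ℂ} (hq : a ^ 2 + b ^ 2 ≠ 0) : (rotatedPolynomial F a b).natDegree ≠ 0 := by
  intro hN
  obtain ⟨φ, hφ⟩ := Polynomial.natDegree_eq_zero.1 hN
  have hev : ∀ x y : ℂ, eval ![x, y] F = φ.eval ((-b * x + a * y) / (a ^ 2 + b ^ 2)) := by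
    intro x y
    have h1 := eval_rotatedPolynomial F a b ((a * x + b * y) / (a ^ 2 + b ^ 2))
      ((-b * x + a * y) / (a ^ 2 + b ^ 2))
    rw [← hφ, Polynomial.eval_C] at h1
    rw [h1]
    congr 2
    funext i
    fin_cases i
    · simp only [Fin.zero_eta, Matrix.cons_val_zero]; field_simp; ring
    · simp only [Fin.mk_one, Matrix.cons_val_one, Matrix.cons_val_fin_one]; field_simp; ring
  obtain ⟨c, hc⟩ := h.exists_const hF
  by_cases hφc : φ - Polynomial.C c = 0
  · apply hFc c
    refine MvPolynomial.funext fun p => ?_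
    have hp : p = ![p 0, p 1] := by funext i; fin_cases i <;> rfl
    rw [hp, hev, sub_eq_zero.1 hφc, Polynomial.eval_C, eval_C]
  · obtain ⟨s, hs⟩ := h.curve.exists_eval_ne_zero (a := -b / (a ^ 2 + b ^ 2))
      (b := a / (a ^ 2 + b ^ 2)) (by
        by_contra! h0
        apply hq
        have h1 : b = 0 := by simpa [hq] using h0.1
        have h2 : a = 0 := by simpa [hq] using h0.2
        rw [h1, h2]; ring) hφc
    apply hs
    have h1 := hc s
    rw [realPointEval, hev] at h1
    rw [Polynomial.eval_sub, Polynomial.eval_C, ← h1, sub_eq_zero]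
    congr 1
    ring

/-- The curve has no non-isotropic transversal point at infinity. -/
theorem not_transversal_at_infinity (h : IsTangentCircleFrame δ v lam kap r L)
    {f F : MvPolynomial (Fin 2) ℂ} (hf : Irreducible f) (hfδ : ∀ s, realPointEval f (δ s) = 0)
    (hFc : ∀ c, F ≠ C c) (hF : IsReflectionInvariant δ v r F)
    {a b : ℂ} (hq : a ^ 2 + b ^ 2 ≠ 0) (h0 : eval ![a, b, 0] (homogenization f) = 0) :
    a * eval ![a, b, 0] (pderiv 1 (homogenization f)) -
      b * eval ![a, b, 0] (pderiv 0 (homogenization f)) = 0 := by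
  by_contra hα
  obtain ⟨y₀, Y, μ, B, hY, hμt, hev⟩ := exists_branch_at_infinity hq h0 hα
  have ht0 : Tendsto (fun t : ℂ => t) (𝓝[≠] 0) (𝓝 0) := tendsto_id.mono_left nhdsWithin_le_nhds
  have hμ : Tendsto μ (𝓝[≠] 0) (𝓝 0) := by
    have h1 := hμt.mul ht0
    rw [zero_mul] at h1
    refine h1.congr' ?_
    filter_upwards [self_mem_nhdsWithin] with t ht
    exact div_mul_cancel₀ _ ht
  obtain ⟨κ, hκ, hκl⟩ := exists_sqrt_one_add_sq hμ
  -- Since |∇f|^2 = B^2 (a^2 + b^2)(1 + μ^2) on the branch, B ℓ κ is a square root of it.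
  obtain ⟨ℓ, hℓ⟩ := IsAlgClosed.exists_pow_nat_eq (a ^ 2 + b ^ 2) (n := 2) (by norm_num)
  have hℓ0 : ℓ ≠ 0 := by
    rintro rfl
    exact hq (by rw [← hℓ]; ring)
  set P := rotatedPolynomial F a b
  have hN := h.natDegree_rotatedPolynomial_ne_zero hFc hF hq
  have hlc : P.leadingCoeff ≠ 0 := Polynomial.leadingCoeff_ne_zero.2 fun hP => hN (by
    change P.natDegree = 0
    rw [hP, Polynomial.natDegree_zero])
  -- The transverse coordinates of the two mirror points have the common limit y₀ + c/ℓ or y₀ - c/ℓ,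
  -- according to σ. The angle is chosen so that the leading coefficient of P vanishes at neither.
  obtain ⟨ε, hε0, hεπ, hε⟩ := exists_angle h.radius_pos
    (mul_ne_zero (comp_affine_ne_zero hlc y₀ (inv_ne_zero hℓ0))
      (comp_affine_ne_zero hlc y₀ (neg_ne_zero.2 (inv_ne_zero hℓ0))))
  rw [Polynomial.eval_mul, Polynomial.eval_comp, Polynomial.eval_comp] at hε
  simp only [Polynomial.eval_add, Polynomial.eval_mul, Polynomial.eval_C, Polynomial.eval_X] at hε
  set c : ℝ := r * (1 - Real.cos ε) with hc
  set S : ℝ := r * Real.sin ε with hS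
  have hS0 : (S : ℂ) ≠ 0 := by
    have : 0 < S := mul_pos h.radius_pos (Real.sin_pos_of_pos_of_lt_pi hε0 hεπ)
    exact_mod_cast this.ne'
  have hθ : Tendsto (fun t => (ℓ * κ t)⁻¹) (𝓝[≠] 0) (𝓝 ℓ⁻¹) := by
    have h1 := (hκl.const_mul ℓ).inv₀ (by rw [mul_one]; exact hℓ0)
    rwa [mul_one] at h1
  -- The sign supplied by `eval_reflection` may depend on t, so the mirror points are separated for
  -- both signs before t is fixed. Their longitudinal offsets tend to ±σS/ℓ; their transverse
  -- difference is a bounded multiple of μ, hence o(t).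
  have sep : ∀ σ : ℂ, (σ = 1 ∨ σ = -1) → ∀ᶠ t in 𝓝[≠] 0,
      (P.eval (Polynomial.C (1 / t + σ * (ℓ * κ t)⁻¹ * (c * μ t + S)))).eval
        (Y t + σ * (ℓ * κ t)⁻¹ * (c - S * μ t)) ≠
      (P.eval (Polynomial.C (1 / t + σ * (ℓ * κ t)⁻¹ * (c * μ t - S)))).eval
        (Y t + σ * (ℓ * κ t)⁻¹ * (c + S * μ t)) := by
    intro σ hσ
    have hσ0 : σ ≠ 0 := by rcases hσ with rfl | rfl <;> norm_num
    have hσθ := hθ.const_mul σ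
    have l1 := hσθ.mul ((hμ.const_mul (c : ℂ)).add_const (S : ℂ))
    have l2 := hσθ.mul ((hμ.const_mul (c : ℂ)).sub_const (S : ℂ))
    have l3 := hY.add (hσθ.mul ((hμ.const_mul (S : ℂ)).const_sub (c : ℂ)))
    have l4 := hY.add (hσθ.mul ((hμ.const_mul (S : ℂ)).const_add (c : ℂ)))
    have l5 := (hσθ.mul (hμt.const_mul (-2 * S : ℂ)))
    simp only [mul_zero, zero_add, zero_sub, sub_zero, add_zero] at l1 l2 l3 l4 l5
    refine eventually_eval_ne hN l1 l2 ?_ ⟨l3, l4, l5.congr fun t => by ring⟩ ?_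
    · intro he
      have h2 : 2 * (σ * ℓ⁻¹ * S) = 0 := by linear_combination he
      have h3 : σ * ℓ⁻¹ * S ≠ 0 := mul_ne_zero (mul_ne_zero hσ0 (inv_ne_zero hℓ0)) hS0
      exact h3 (by simpa using h2)
    · rcases hσ with rfl | rfl
      · rw [one_mul]; exact left_ne_zero_of_mul hε
      · rw [neg_one_mul]; exact right_ne_zero_of_mul hε
  have hne : ∀ᶠ t : ℂ in 𝓝[≠] 0, t ≠ 0 := self_mem_nhdsWithin
  obtain ⟨t, ⟨hpf, hB, hx, hy⟩, hs1, hs2, ht, hκ0⟩ := (hev.and ((sep 1 (Or.inl rfl)).and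
    ((sep (-1) (Or.inr rfl)).and (hne.and
      (hκl.eventually_ne one_ne_zero))))).exists
  have hw : (B t * ℓ * κ t) ^ 2 =
      eval ![a / t - b * Y t, b / t + a * Y t] (gradSq f) := by
    rw [gradSq, map_add, map_pow, map_pow, hx, hy, mul_pow, mul_pow, hκ, hℓ]
    ring
  have hw0 : B t * ℓ * κ t ≠ 0 := mul_ne_zero (mul_ne_zero hB hℓ0) hκ0
  obtain ⟨σ, hσ, e⟩ := h.eval_reflection hf hfδ hF hε0 hεπ hpf hw0 hw
  rw [← hc, ← hS] at e
  have hσ0 : σ ≠ 0 := by rcases hσ with rfl | rfl <;> norm_num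
  have hσi : σ⁻¹ = σ := by rcases hσ with rfl | rfl <;> norm_num
  have hpt : ∀ S : ℂ, (fun i => ![a / t - b * Y t, b / t + a * Y t] i +
      eval ![a / t - b * Y t, b / t + a * Y t] (frameShift f c S i) / (σ * (B t * ℓ * κ t))) =
      ![a * (1 / t + σ * (ℓ * κ t)⁻¹ * (c * μ t + S)) - b * (Y t + σ * (ℓ * κ t)⁻¹ * (c - S * μ t)),
        b * (1 / t + σ * (ℓ * κ t)⁻¹ * (c * μ t + S)) +
          a * (Y t + σ * (ℓ * κ t)⁻¹ * (c - S * μ t))] := by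
    intro S
    nth_rewrite 2 3 4 5 [← hσi]
    funext i
    fin_cases i
    · simp only [frameShift, Fin.zero_eta, Matrix.cons_val_zero, map_add, map_mul, eval_C, hx, hy]
      field_simp
      ring
    · simp only [frameShift, Fin.mk_one, Matrix.cons_val_one, Matrix.cons_val_fin_one, map_sub,
        map_mul, eval_C, hx, hy]
      field_simp
      ring
  rw [hpt, hpt, ← eval_rotatedPolynomial, ← eval_rotatedPolynomial, neg_mul, sub_neg_eq_add,
    ← sub_eq_add_neg] at e
  rcases hσ with rfl | rfl
  · exact hs1 e
  · exact hs2 e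

/-- Off the isotropic points Z₀^2 + Z₁^2 ≠ 0. Non-transversality and Euler's relation are then two
independent linear equations that annihilate the first two partial derivatives, which leaves z = 0
as the tangent line. -/
theorem isTangentAtInfinity (h : IsTangentCircleFrame δ v lam kap r L)
    {f F : MvPolynomial (Fin 2) ℂ} (hf : Irreducible f) (hfδ : ∀ s, realPointEval f (δ s) = 0)
    (hFc : ∀ c, F ≠ C c) (hF : IsReflectionInvariant δ v r F) : IsTangentAtInfinity f := by
  intro Z hZ hZ2 ⟨hZ0, hns⟩ hiso
  have hZe : Z = ![Z 0, Z 1, 0] := by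
    funext i; fin_cases i
    · rfl
    · rfl
    · exact hZ2
  have hq : Z 0 ^ 2 + Z 1 ^ 2 ≠ 0 := by
    intro h0
    have h1 : (Z 1 - Complex.I * Z 0) * (Z 1 + Complex.I * Z 0) = 0 := by
      linear_combination h0 - Z 0 ^ 2 * Complex.I_mul_I
    have hZ00 : Z 0 ≠ 0 := by
      intro h2
      rw [h2] at h0
      apply hZ
      have h3 : Z 1 = 0 := by simpa using h0
      rw [hZe, h2, h3]
      funext i; fin_cases i <;> rfl
    apply hiso
    refine ⟨Z 0, hZ00, ?_⟩
    rcases mul_eq_zero.1 h1 with h2 | h2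
    · left
      rw [hZe]
      funext i; fin_cases i
      · simp
      · simp; linear_combination h2
      · simp
    · right
      rw [hZe]
      funext i; fin_cases i
      · simp
      · simp; linear_combination h2
      · simp
  have hα := h.not_transversal_at_infinity hf hfδ hFc hF hq (by rw [← hZe]; exact hZ0)
  rw [← hZe] at hα
  have he := euler_homogenization f Z
  rw [hZ0, hZ2, mul_zero, zero_mul, add_zero] at he
  have e0 : eval Z (pderiv 0 (homogenization f)) = 0 := by
    have : (Z 0 ^ 2 + Z 1 ^ 2) * eval Z (pderiv 0 (homogenization f)) = 0 := by
      linear_combination Z 0 * he - Z 1 * hα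
    exact (mul_eq_zero.1 this).resolve_left hq
  have e1 : eval Z (pderiv 1 (homogenization f)) = 0 := by
    have : (Z 0 ^ 2 + Z 1 ^ 2) * eval Z (pderiv 1 (homogenization f)) = 0 := by
      linear_combination Z 1 * he + Z 0 * hα
    exact (mul_eq_zero.1 this).resolve_left hq
  have e2 : eval Z (pderiv 2 (homogenization f)) ≠ 0 := by
    obtain ⟨i, hi⟩ := hns
    fin_cases i
    · exact absurd e0 hi
    · exact absurd e1 hi
    · exact hi
  ext W
  simp [projTangentLine, Fin.sum_univ_three, e0, e1, e2]

end IsTangentCircleFrame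

end OuterMagneticBilliard

/-! ### The two envelopes of the Larmor circles -/

namespace OuterMagneticBilliard

open Filter Topology Asymptotics

theorem complexify_ne_C {F : MvPolynomial (Fin 2) ℝ} (hF : ∀ c : ℝ, F ≠ MvPolynomial.C c) (c : ℂ) :
    complexify F ≠ MvPolynomial.C c := by
  intro h
  apply hF (MvPolynomial.coeff 0 F)
  ext d
  have h1 := congrArg (MvPolynomial.coeff d) h
  rw [complexify, MvPolynomial.coeff_map, MvPolynomial.coeff_C] at h1
  rw [MvPolynomial.coeff_C]
  split_ifs at h1 ⊢ with hd
  · rw [hd]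
  · exact (FaithfulSMul.algebraMap_injective ℝ ℂ) (by rw [h1, map_zero])

section SmoothCurve

variable {Γ : ℝ → ℂ} {L : ℝ}

theorem hasDerivAt_curve (hΓ : IsSmoothSimpleClosedCurve Γ L) (s : ℝ) :
    HasDerivAt Γ (deriv Γ s) s :=
  (hΓ.smooth.differentiable (by simp) s).hasDerivAt

theorem contDiff_tangent (hΓ : IsSmoothSimpleClosedCurve Γ L) :
    ContDiff ℝ (⊤ : ℕ∞) (deriv Γ) :=
  (contDiff_infty_iff_deriv.1 hΓ.smooth).2

theorem hasDerivAt_tangent (hΓ : IsSmoothSimpleClosedCurve Γ L) (s : ℝ) :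
    HasDerivAt (deriv Γ) (signedCurvature Γ s * (Complex.I * deriv Γ s)) s := by
  have hd : ∀ s, HasDerivAt (deriv Γ) (deriv (deriv Γ) s) s := fun s =>
    ((contDiff_tangent hΓ).differentiable (by simp) s).hasDerivAt
  have hsq : ∀ s, (deriv Γ s).re ^ 2 + (deriv Γ s).im ^ 2 = 1 := fun s => by
    have h1 := Complex.sq_norm (deriv Γ s)
    rw [hΓ.unit_speed, Complex.normSq_apply] at h1
    linarith
  have hre : HasDerivAt (fun t => (deriv Γ t).re) (deriv (deriv Γ) s).re s :=
    Complex.reCLM.hasFDerivAt.comp_hasDerivAt s (hd s)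
  have him : HasDerivAt (fun t => (deriv Γ t).im) (deriv (deriv Γ) s).im s :=
    Complex.imCLM.hasFDerivAt.comp_hasDerivAt s (hd s)
  have horth : (deriv Γ s).re * (deriv (deriv Γ) s).re
      + (deriv Γ s).im * (deriv (deriv Γ) s).im = 0 := by
    have h1 := (hre.pow 2).add (him.pow 2)
    have h2 : ((fun t => (deriv Γ t).re) ^ 2 + (fun t => (deriv Γ t).im) ^ 2) = fun _ => (1 : ℝ) :=
      funext hsq
    rw [h2] at h1
    have h3 := h1.unique (hasDerivAt_const s 1)
    norm_num at h3
    linarith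
  have hval : deriv (deriv Γ) s = signedCurvature Γ s * (Complex.I * deriv Γ s) := by
    have h1 := hsq s
    apply Complex.ext
    · simp [signedCurvature, planeDet]
      linear_combination (-(deriv (deriv Γ) s).re) * h1 + (deriv Γ s).re * horth
    · simp [signedCurvature, planeDet]
      linear_combination (-(deriv (deriv Γ) s).im) * h1 + (deriv Γ s).im * horth
  rw [← hval]
  exact hd s

/-- Were the curvature positive at s, the signed distance to the tangent line would have a local
minimum 0 there. Being nonpositive by convexity, it would vanish near s, and so would its second
derivative, which at s is the curvature. -/
theorem signedCurvature_nonpos (hΓ : IsSmoothSimpleClosedCurve Γ L) (hc : IsConvexClockwise Γ)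
    (s : ℝ) : signedCurvature Γ s ≤ 0 := by
  by_contra! hk
  set φ : ℝ → ℝ := fun t => planeDet (deriv Γ s) (Γ t - Γ s) with hφ
  have h1 : ∀ t, HasDerivAt φ (planeDet (deriv Γ s) (deriv Γ t)) t := by
    intro t
    have hd := (hasDerivAt_curve hΓ t).sub_const (Γ s)
    have hre : HasDerivAt (fun t => (Γ t - Γ s).re) (deriv Γ t).re t :=
      Complex.reCLM.hasFDerivAt.comp_hasDerivAt t hd
    have him : HasDerivAt (fun t => (Γ t - Γ s).im) (deriv Γ t).im t :=
      Complex.imCLM.hasFDerivAt.comp_hasDerivAt t hd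
    exact (him.const_mul _).sub (hre.const_mul _)
  have h2 : HasDerivAt (fun t => planeDet (deriv Γ s) (deriv Γ t)) (signedCurvature Γ s) s := by
    have hd : HasDerivAt (deriv Γ) (deriv (deriv Γ) s) s :=
      ((contDiff_tangent hΓ).differentiable (by simp) s).hasDerivAt
    have hre : HasDerivAt (fun t => (deriv Γ t).re) (deriv (deriv Γ) s).re s :=
      Complex.reCLM.hasFDerivAt.comp_hasDerivAt s hd
    have him : HasDerivAt (fun t => (deriv Γ t).im) (deriv (deriv Γ) s).im s :=
      Complex.imCLM.hasFDerivAt.comp_hasDerivAt s hd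
    exact (him.const_mul _).sub (hre.const_mul _)
  have e1 : deriv φ = fun t => planeDet (deriv Γ s) (deriv Γ t) := funext fun t => (h1 t).deriv
  have hs0 : φ s = 0 := by simp [hφ, planeDet]
  have hmin : IsLocalMin φ s := by
    refine isLocalMin_of_deriv_deriv_pos ?_ ?_ (h1 s).continuousAt
    · rw [e1, h2.deriv]; exact hk
    · rw [e1]; simp only [planeDet]; ring
  have hev : φ =ᶠ[𝓝 s] fun _ => (0 : ℝ) := by
    filter_upwards [hmin] with t ht
    rw [hs0] at ht
    exact le_antisymm (hc s t) ht
  have h3 := hev.deriv.deriv_eq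
  rw [e1, h2.deriv] at h3
  simp at h3
  exact hk.ne' h3

theorem isTangentCircleFrame_curve (hΓ : IsSmoothSimpleClosedCurve Γ L) {r : ℝ} (hr : 0 < r)
    (hk : ∀ s, r * signedCurvature Γ s ≠ 1) :
    IsTangentCircleFrame Γ (deriv Γ) (fun _ => 1) (signedCurvature Γ) r L where
  curve :=
    { length_pos := hΓ.length_pos
      smooth := hΓ.smooth
      deriv_ne := fun s h => by
        have := hΓ.unit_speed s
        rw [h, norm_zero] at this
        exact zero_ne_one this
      periodic := hΓ.periodic }
  norm_v := hΓ.unit_speed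
  hasDerivAt_curve s := by simpa using hasDerivAt_curve hΓ s
  hasDerivAt_v := hasDerivAt_tangent hΓ
  lam_ne _ := one_ne_zero
  contact := hk
  radius_pos := hr

/-- The choice v = -τ makes the centre δ + rJv equal to Γ + rJτ, so the tangent circles are the same
Larmor circles. Here δ' = (2rk - 1) v, and rk = 2rk - 1 exactly when rk = 1. -/
theorem isTangentCircleFrame_parallelCurve (hΓ : IsSmoothSimpleClosedCurve Γ L) {r : ℝ}
    (hr : 0 < r) (hk : ∀ s, r * signedCurvature Γ s ≠ 1)
    (hk' : ∀ s, 2 * r * signedCurvature Γ s - 1 ≠ 0) :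
    IsTangentCircleFrame (parallelCurve Γ (2 * r)) (fun s => -deriv Γ s)
      (fun s => 2 * r * signedCurvature Γ s - 1) (signedCurvature Γ) r L := by
  have hd : ∀ s, HasDerivAt (parallelCurve Γ (2 * r))
      ((2 * r * signedCurvature Γ s - 1 : ℝ) * -deriv Γ s) s := by
    intro s
    have h1 := (hasDerivAt_curve hΓ s).add
      (((hasDerivAt_tangent hΓ s).const_mul Complex.I).const_mul ((2 * r : ℝ) : ℂ))
    convert! h1 using 1
    push_cast
    linear_combination (-(2 * r * signedCurvature Γ s * deriv Γ s : ℂ)) * Complex.I_mul_I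
  have hp : Function.Periodic (deriv Γ) L := by
    intro s
    have h1 : (fun t => Γ (t + L)) = Γ := funext hΓ.periodic
    rw [← deriv_comp_add_const, h1]
  refine ⟨⟨hΓ.length_pos, ?_, fun s => ?_, fun s => ?_⟩, fun s => ?_, hd, fun s => ?_, hk',
    fun s => ?_, hr⟩
  · exact hΓ.smooth.add (contDiff_const.mul (contDiff_const.mul (contDiff_tangent hΓ)))
  · rw [(hd s).deriv, ← norm_ne_zero_iff, norm_mul, norm_neg, hΓ.unit_speed, mul_one,
      norm_ne_zero_iff]
    exact_mod_cast hk' s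
  · simp only [parallelCurve]
    rw [hΓ.periodic, hp]
  · rw [norm_neg, hΓ.unit_speed]
  · have := (hasDerivAt_tangent hΓ s).neg
    convert! this using 1
    ring
  · intro h
    apply hk s
    linarith

theorem isReflectionInvariant_curve {r : ℝ} {F : MvPolynomial (Fin 2) ℝ}
    (hinv : IsOuterBilliardInvariant Γ r F) :
    IsReflectionInvariant Γ (deriv Γ) r (complexify F) := by
  intro s ε h0 hπ
  have hpt : ∀ ε, circlePoint Γ (deriv Γ) r s ε = larmorPoint Γ r s ε := by
    intro ε
    simp only [circlePoint, larmorPoint, parallelCurve]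
    ring
  rw [realPointEval_complexify, realPointEval_complexify, hpt, hpt,
    hinv _ _ ⟨s, ε, h0, hπ, rfl, rfl⟩]

/-- The points of tangency are antipodal, so the angle ε from one is the angle ε - π from the other.
Both pairs of mirror points come from the same reflection, with ε replaced by π - ε. -/
theorem isReflectionInvariant_parallelCurve {r : ℝ} {F : MvPolynomial (Fin 2) ℝ}
    (hinv : IsOuterBilliardInvariant Γ r F) :
    IsReflectionInvariant (parallelCurve Γ (2 * r)) (fun s => -deriv Γ s) r (complexify F) := by
  intro s ε h0 hπ
  have h1 : circlePoint (parallelCurve Γ (2 * r)) (fun s => -deriv Γ s) r s ε =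
      larmorPoint Γ r s (-(Real.pi - ε)) := by
    simp only [circlePoint, larmorPoint, parallelCurve]
    have : Complex.exp ((-(Real.pi - ε) : ℝ) * Complex.I) = - Complex.exp (ε * Complex.I) := by
      rw [show ((-(Real.pi - ε) : ℝ) : ℂ) * Complex.I = ε * Complex.I - Real.pi * Complex.I by
        push_cast; ring, Complex.exp_sub_pi_mul_I]
    rw [this]
    push_cast
    ring
  have h2 : circlePoint (parallelCurve Γ (2 * r)) (fun s => -deriv Γ s) r s (-ε) =
      larmorPoint Γ r s (Real.pi - ε) := by
    simp only [circlePoint, larmorPoint, parallelCurve]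
    have : Complex.exp ((Real.pi - ε : ℝ) * Complex.I) =
        - Complex.exp ((-ε : ℝ) * Complex.I) := by
      rw [show ((Real.pi - ε : ℝ) : ℂ) * Complex.I = (-ε : ℝ) * Complex.I + Real.pi * Complex.I by
        push_cast; ring, Complex.exp_add_pi_mul_I]
    rw [this]
    push_cast
    ring
  rw [realPointEval_complexify, realPointEval_complexify, h1, h2,
    hinv _ _ ⟨s, Real.pi - ε, by linarith, by linarith, rfl, rfl⟩]

end SmoothCurve

namespace IsTangentCircleFrame

variable {δ v : ℝ → ℂ} {lam kap : ℝ → ℝ} {r L : ℝ}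

theorem exists_isDefiningPolynomial (h : IsTangentCircleFrame δ v lam kap r L)
    {F : MvPolynomial (Fin 2) ℂ} (hFc : ∀ c, F ≠ MvPolynomial.C c)
    (hF : IsReflectionInvariant δ v r F) : ∃ f, IsDefiningPolynomial δ f := by
  obtain ⟨c, hc⟩ := h.exists_const hF
  refine h.curve.exists_isDefiningPolynomial (sub_ne_zero.2 (hFc c)) fun s => ?_
  have := hc s
  rw [realPointEval] at this
  rw [realPointEval, map_sub, this, MvPolynomial.eval_C, sub_self]

end IsTangentCircleFrame

theorem IsDefiningPolynomial.realPointEval_eq_zero {δ : ℝ → ℂ} {f : MvPolynomial (Fin 2) ℝ}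
    (hf : IsDefiningPolynomial δ f) (s : ℝ) : realPointEval (complexify f) (δ s) = 0 := by
  rw [realPointEval_complexify, hf.2 s, Complex.ofReal_zero]

end OuterMagneticBilliard

open OuterMagneticBilliard in
theorem mainTheorem4 (β : ℝ) (hβ : 0 < β) (L : ℝ) (Γ : ℝ → ℂ)
    (hΓ : IsSmoothSimpleClosedCurve Γ L)
    (horient : IsConvexClockwise Γ ∨
      (IsConvexCounterclockwise Γ ∧ ∀ s, β < signedCurvature Γ s))
    (F : MvPolynomial (Fin 2) ℝ) (hF : ∀ c : ℝ, F ≠ MvPolynomial.C c)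
    (hinv : IsOuterBilliardInvariant Γ (1 / β) F) :
    (∃ f, IsDefiningPolynomial Γ f) ∧
    (∃ f₂, IsDefiningPolynomial (parallelCurve Γ (2 * (1 / β))) f₂) ∧
    ∀ f f₂ : MvPolynomial (Fin 2) ℝ,
      IsDefiningPolynomial Γ f →
      IsDefiningPolynomial (parallelCurve Γ (2 * (1 / β))) f₂ →
      IsCircleCurve Γ ∨
        ((IsSmoothAffineCurve (complexify f) ∧ IsSmoothAffineCurve (complexify f₂)) ∧
          (IsTangentAtInfinity (complexify f) ∧ IsTangentAtInfinity (complexify f₂))) := by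
  have hr : 0 < 1 / β := one_div_pos.2 hβ
  -- Either orientation keeps rk away from 1 (no osculation) and from 1/2 (regularity of the
  -- parallel curve).
  have hk : ∀ s, 1 / β * signedCurvature Γ s ≤ 0 ∨ 1 < 1 / β * signedCurvature Γ s := by
    intro s
    rcases horient with h | ⟨-, h⟩
    · exact Or.inl (mul_nonpos_of_nonneg_of_nonpos hr.le (signedCurvature_nonpos hΓ h s))
    · right
      rw [one_div, inv_mul_eq_div, lt_div_iff₀ hβ, one_mul]
      exact h s
  have hk1 : ∀ s, 1 / β * signedCurvature Γ s ≠ 1 := fun s => by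
    rcases hk s with h | h <;> intro h' <;> linarith
  have hk2 : ∀ s, 2 * (1 / β) * signedCurvature Γ s - 1 ≠ 0 := fun s => by
    rcases hk s with h | h <;> intro h' <;> nlinarith
  have A₁ := isTangentCircleFrame_curve hΓ hr hk1
  have A₂ := isTangentCircleFrame_parallelCurve hΓ hr hk1 hk2
  have I₁ := isReflectionInvariant_curve hinv
  have I₂ := isReflectionInvariant_parallelCurve hinv
  have hFc := complexify_ne_C hF
  -- The second alternative is proved in every case. It is consistent with circles, which are smooth
  -- and meet the line at infinity only in the isotropic points.
  refine ⟨A₁.exists_isDefiningPolynomial hFc I₁, A₂.exists_isDefiningPolynomial hFc I₂,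
    fun f f₂ hf hf₂ => Or.inr ⟨⟨?_, ?_⟩, ?_, ?_⟩⟩
  · exact A₁.isSmoothAffineCurve hf.1 (IsDefiningPolynomial.realPointEval_eq_zero hf) hFc I₁
  · exact A₂.isSmoothAffineCurve hf₂.1 (IsDefiningPolynomial.realPointEval_eq_zero hf₂) hFc I₂
  · exact A₁.isTangentAtInfinity hf.1 (IsDefiningPolynomial.realPointEval_eq_zero hf) hFc I₁
  · exact A₂.isTangentAtInfinity hf₂.1 (IsDefiningPolynomial.realPointEval_eq_zero hf₂) hFc I₂
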